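/- **Setting.** Types $\theta\in\Theta=[0,1]$ have a twice differentiable distribution function $F$ on $[0,1]$ with $F(0)=0$, $F(1)=1$, positive density on $[0,1)$ and increasing virtual value $\varphi(\theta)=\theta-\frac{1-F(\theta)}{F'(\theta)}$. Utility is $u(q,\theta)=g(q)+\theta q$ for qualities $q\ge 0$, where $g$ is continuous on $[0,\infty)$, twice differentiable on $(0,\infty)$, increasing and strictly concave, with $g(0)=0$, $\lim_{q\to0}g'(q)=\infty$, $\lim_{q\to\infty}g'(q)=0$. The cost $c:[0,\infty)\to[0,\infty)$ is increasing, strictly convex and differentiable with $c'(0)=0$, $\lim_{q\to\infty}c'(q)=\infty$. An allocation is a measurable $\mathbf q:\Theta\to[0,\infty)$; its welfare is $W(\mathbf q)=\int_\Theta u(\mathbf q(\theta),\theta)\,dF(\theta)-c(\sup\mathbf q)$. A monopolist allocation $\mathbf q^M$ is one that, with some transfers $t$, maximizes $\int t\,dF-c(\sup\mathbf q)$ over all incentive-compatible and individually rational direct mechanisms $(\mathbf q,t)$. Let $V(q)$ be the supremum of $\int_\Theta g(\mathbf q(\theta))+\varphi(\theta)\mathbf q(\theta)\,dF(\theta)$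 over nondecreasing allocations with $\mathbf q\le q$, let $q^M$ maximize $V-c$ on $[0,\infty)$, and let $\beta(\theta)$ be the (largest) maximizer of $q\mapsto g(q)+\varphi(\theta)q$ on $[0,\infty)$, with $\beta(\theta)=\infty$ if $\varphi(\theta)\ge0$. For caps $x\ge y$ let $\mathbf q[x,y](\theta)=\max\{\min\{\beta(\theta),x\},y\}$. For $n\ge2$, in the symmetric competitive equilibrium with $n$ active firms these draw i.i.d. caps $q_1,\dots,q_n$ from the distribution function $H_n(q)=(c'(q)/V'(q))^{1/(n-1)}$ on $[0,q^M]$, $H_n(q)=1$ for $q>q^M$. Let $\mathbb E_n$ be the resulting expectation and $\hat x,\hat y$ the highest and second-highest caps. Write $\mathcal W_n$ for either of the following two measures of expected welfare: $$\mathbb E_n\{W(\mathbf q[\hat x,\hat y])\}\qquad\text{or}\qquad \mathbb E_n\Big\{\int_\Theta u(\mathbf q[\hat x,\hat y](\theta),\theta)\,dF(\theta)-\sum_{i=1}^n c(q_i)\Big\}$$ (the second one charges the investment costs of all active firms). The following hold for both. 1. $\mathcal W_{n+1}\le\mathcal W_n$ for all $n\ge2$. 2. If $q^M\le\beta(0)$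 (full bunching), then $W(\mathbf q^M)>\mathcal W_2$. 3. Let $F$ be uniform, $c(q)=(q/a)^\alpha$ with $\alpha>1$, and let $g$ be as above or $g=0$ (linear utility). If $a>\beta(0)$, then $W(\mathbf q^M)$ and $\mathcal W_2$ converge as $\alpha\to\infty$, and $\lim_{\alpha\to\infty}W(\mathbf q^M)<\lim_{\alpha\to\infty}\mathcal W_2$, the latter limit being the same for both measures. 4. Let $F$ be uniform, $g=0$ and $c(q)=(q/a)^\alpha$ with $a>0$, $\alpha>1$. Then $\mathcal W_2-W(\mathbf q^M)\to a/8$ as $\alpha\to\infty$. -/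

import Mathlib

open Set Filter Topology MeasureTheory

noncomputable section

namespace DigitalMonopoly

/-! ### Primitives: a type distribution function `F` on `[0,1]`, a common utility term `g` and a
cost function `c` on qualities `q ≥ 0`. Only the values of `F` on `[0,1]` and of `g`, `c` on
`[0,∞)` matter. -/

/-- The set of buyer types. -/
def Θ : Set ℝ := Icc 0 1

/-- The density `F'` on `[0,1]` (one-sided at the endpoints). -/
def density (F : ℝ → ℝ) (θ : ℝ) : ℝ := derivWithin F Θ θ

/-- The virtual value `φ(θ) = θ - (1 - F(θ)) / F'(θ)`. -/
def virtualValue (F : ℝ → ℝ) (θ : ℝ) : ℝ := θ - (1 - F θ) / density F θ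

/-- The law `dF` of the type. -/
def typeLaw (F : ℝ → ℝ) : Measure ℝ :=
  (volume.restrict Θ).withDensity (fun θ => ENNReal.ofReal (density F θ))

/-- `F` is a twice differentiable distribution function with support `[0,1]`, whose virtual value
is well defined and (strictly) increasing. -/
structure RegularTypes (F : ℝ → ℝ) : Prop where
  map_zero : F 0 = 0
  map_one : F 1 = 1
  differentiable : DifferentiableOn ℝ F Θ
  density_differentiable : DifferentiableOn ℝ (density F) Θ
  density_pos : ∀ θ ∈ Ico (0 : ℝ) 1, 0 < density F θ
  virtualValue_strictMono : StrictMonoOn (virtualValue F) Θ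

/-- `g` is increasing, strictly concave, twice differentiable, null at zero, and satisfies the
Inada conditions `g'(0) = ∞`, `g'(∞) = 0`. -/
structure RegularUtility (g : ℝ → ℝ) : Prop where
  map_zero : g 0 = 0
  strictMono : StrictMonoOn g (Ici 0)
  strictConcave : StrictConcaveOn ℝ (Ici 0) g
  continuous : ContinuousOn g (Ici 0)
  differentiable : DifferentiableOn ℝ g (Ioi 0)
  deriv_differentiable : DifferentiableOn ℝ (deriv g) (Ioi 0)
  inada_zero : Tendsto (deriv g) (𝓝[>] 0) atTop
  inada_top : Tendsto (deriv g) atTop (𝓝 0)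

/-- `c` is nonnegative, increasing, strictly convex, differentiable, and satisfies the Inada
conditions `c'(0) = 0`, `c'(∞) = ∞`. -/
structure RegularCost (c : ℝ → ℝ) : Prop where
  nonneg : ∀ q, 0 ≤ q → 0 ≤ c q
  strictMono : StrictMonoOn c (Ici 0)
  strictConvex : StrictConvexOn ℝ (Ici 0) c
  differentiable : DifferentiableOn ℝ c (Ici 0)
  inada_zero : HasDerivWithinAt c 0 (Ici 0) 0
  inada_top : Tendsto (deriv c) atTop atTop

/-! ### Allocations, welfare and the monopolist -/

/-- The utility `u(q,θ) = g(q) + θ q`. -/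
def utility (g : ℝ → ℝ) (q θ : ℝ) : ℝ := g q + θ * q

/-- An allocation is a measurable map from types to nonnegative qualities. -/
def IsAllocation (A : ℝ → ℝ) : Prop :=
  Measurable (Θ.domRestrict A) ∧ ∀ θ ∈ Θ, 0 ≤ A θ

/-- The highest quality of an allocation. -/
def topQuality (A : ℝ → ℝ) : ℝ := sSup (A '' Θ)

/-- The aggregate utility `∫ u(A(θ),θ) dF(θ)` from an allocation. -/
def grossSurplus (F g : ℝ → ℝ) (A : ℝ → ℝ) : ℝ :=
  ∫ θ, utility g (A θ) θ ∂(typeLaw F)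

/-- The welfare `W(A) = ∫ u(A(θ),θ) dF(θ) - c(sup A)` of an allocation. -/
def welfare (F g c : ℝ → ℝ) (A : ℝ → ℝ) : ℝ :=
  grossSurplus F g A - c (topQuality A)

/-- Incentive-compatible and individually rational direct mechanisms. -/
structure IsMechanism (g : ℝ → ℝ) (A t : ℝ → ℝ) : Prop where
  allocation : IsAllocation A
  incentive : ∀ θ ∈ Θ, ∀ θ' ∈ Θ, utility g (A θ') θ - t θ' ≤ utility g (A θ) θ - t θ
  participation : ∀ θ ∈ Θ, 0 ≤ utility g (A θ) θ - t θ

/-- The monopolist's profit from a mechanism. -/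
def profit (F c : ℝ → ℝ) (A t : ℝ → ℝ) : ℝ :=
  ∫ θ, t θ ∂(typeLaw F) - c (topQuality A)

/-- `A` is a monopolist allocation: with suitable transfers it maximizes the monopolist's profit
among all incentive-compatible and individually rational mechanisms. -/
def IsMonopolist (F g c : ℝ → ℝ) (A : ℝ → ℝ) : Prop :=
  ∃ t, IsMechanism g A t ∧ ∀ A' t', IsMechanism g A' t' → profit F c A' t' ≤ profit F c A t

/-- The revenue function `V(q)`: the value of maximizing the virtual surplus over nondecreasing
allocations with qualities at most `q`. -/
def revenue (F g : ℝ → ℝ) (q : ℝ) : ℝ :=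
  sSup {r | ∃ A, IsAllocation A ∧ MonotoneOn A Θ ∧ (∀ θ ∈ Θ, A θ ≤ q) ∧
    r = ∫ θ, (g (A θ) + virtualValue F θ * A θ) ∂(typeLaw F)}

/-- The monopolist cap `q^M`: a maximizer of `V - c` on `[0,∞)`. -/
def IsMonopolyCap (F g c : ℝ → ℝ) (qM : ℝ) : Prop :=
  0 ≤ qM ∧ ∀ q, 0 ≤ q → revenue F g q - c q ≤ revenue F g qM - c qM

open Classical in
/-- The virtual-surplus maximizer `β(θ)`: the (largest) maximizer of `q ↦ g(q) + φ(θ) q` on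
`[0,∞)`, and `∞` if `φ(θ) ≥ 0`. -/
def virtualMaximizer (F g : ℝ → ℝ) (θ : ℝ) : ENNReal :=
  if 0 ≤ virtualValue F θ then ⊤
  else sSup (ENNReal.ofReal ''
    {q | 0 ≤ q ∧ ∀ q', 0 ≤ q' → g q' + virtualValue F θ * q' ≤ g q + virtualValue F θ * q})

/-! ### Competition -/

/-- The allocation `A[x,y](θ) = max {min {β(θ), x}, y}` induced by a highest cap `x` and a
second-highest cap `y`. -/
def competitiveAllocation (F g : ℝ → ℝ) (x y θ : ℝ) : ℝ :=
  max (min (virtualMaximizer F g θ) (ENNReal.ofReal x)).toReal y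

/-- The equilibrium distribution function of an active firm's cap with `n ≥ 2` active firms:
`H_n(q) = (c'(q) / V'(q)) ^ (1 / (n - 1))` on `[0, q^M]` and `1` above `q^M`. It vanishes at `0`,
because `c'(0) = 0`. -/
def capCdf (F g c : ℝ → ℝ) (qM : ℝ) (n : ℕ) (q : ℝ) : ℝ :=
  if q ≤ 0 then 0
  else if q ≤ qM then (deriv c q / deriv (revenue F g) q) ^ (1 / ((n : ℝ) - 1))
  else 1

/-- `ν` is the equilibrium mixed investment strategy (the law of the cap) of each active firm in
a symmetric equilibrium with `n` active firms. -/
def IsCapLaw (F g c : ℝ → ℝ) (n : ℕ) (ν : Measure ℝ) : Prop :=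
  IsProbabilityMeasure ν ∧
    ∃ qM, IsMonopolyCap F g c qM ∧ ∀ q, ν.real (Iic q) = capCdf F g c qM n q

/-- The highest cap in a profile. -/
def highestCap {n : ℕ} (k : Fin n → ℝ) : ℝ := ⨆ i, k i

/-- The second-highest cap in a profile of at least two caps (counting multiplicity): the
smallest, over the firms `i`, of the highest cap among the firms other than `i`. -/
def secondCap {n : ℕ} (k : Fin n → ℝ) : ℝ := ⨅ i, ⨆ j : {j : Fin n // j ≠ i}, k j

/-- `𝔼_n{W(A[x̂,ŷ])}`: expected welfare of the allocation induced by `n` independent caps with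
law `ν`. -/
def expectedWelfare (F g c : ℝ → ℝ) (n : ℕ) (ν : Measure ℝ) : ℝ :=
  ∫ k : Fin n → ℝ, welfare F g c (competitiveAllocation F g (highestCap k) (secondCap k))
    ∂(Measure.pi fun _ => ν)

/-- Expected total surplus (consumer surplus plus the profits of all active firms): as
`expectedWelfare`, but net of the investment costs of all `n` active firms, not only of the
highest cap. Transfers cancel. -/
def expectedNetSurplus (F g c : ℝ → ℝ) (n : ℕ) (ν : Measure ℝ) : ℝ :=
  ∫ k : Fin n → ℝ,
    (grossSurplus F g (competitiveAllocation F g (highestCap k) (secondCap k)) - ∑ i, c (k i))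
    ∂(Measure.pi fun _ => ν)

/-! ### The family of environments approximating a fixed cost -/

/-- The distribution function of the uniform distribution on `[0,1]`. -/
def uniformTypes (θ : ℝ) : ℝ := θ

/-- The cost function `c(q) = (q / a) ^ α`. -/
def powerCost (a α : ℝ) (q : ℝ) : ℝ := (q / a) ^ α

/-- The utility term of linear preferences `u(q,θ) = θ q`. -/
def linearUtility (_ : ℝ) : ℝ := 0

end DigitalMonopoly

end

open DigitalMonopoly

/-! Write β_x for the virtual-surplus maximizer truncated at x. The utility from the allocation with
caps x ≥ y splits type by type into S(x) + D(y), where S is the surplus of β_x (`truncatedSurplus`)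
and D the gain from lifting β_y to the floor y (`floorGain`). Expected welfare therefore depends
only on the marginal laws of the two highest caps. Moreover S = V + R, where R is the information
rent; V, R and D are all nondecreasing, V is concave, and so V - c and S - c are nondecreasing on
[0, q^M].

Monotonicity in n. The power H_n^(n-1) = c'/V' =: r does not depend on n. The highest cap has
distribution function r H_n and the second-highest r (n - (n-1) H_n); both rise with n, the second
by Bernoulli's inequality (`pow_comparison`). So both caps fall in first-order stochastic dominance,
while welfare is the expectation of S - c at the highest cap plus that of D at the second. If all
investments are charged, the identity V' H_n^(n-1) = c' integrates to a zero-profit condition, which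
leaves E R(highest) + E (V + D)(second) - n c(0); this falls with n for the same reason.

Monopoly. The envelope formula turns expected transfers into virtual surplus, so a monopolist
allocation must equal β_x at x = q^M almost everywhere and has welfare S(q^M) - c(q^M). Under full
bunching D vanishes and R is linear with positive slope on [0, q^M], while the duopolists' highest
cap is below q^M with positive probability; hence monopoly is strictly better.

Nearly fixed costs. As α → ∞ the monopoly cap and both duopoly caps concentrate at a, and investment
costs vanish. The limits are S(a) and S(a) + D(a). The difference D(a) is positive when β(0) < a,
and for linear utility it is the integral of θ a over [0, 1/2]. -/

namespace DigitalMonopoly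

/-! ### Regular type distributions and their virtual values -/

section Types
variable {F : ℝ → ℝ}

theorem RegularTypes.hasDerivAt (hF : RegularTypes F) {θ : ℝ} (hθ : θ ∈ Ioo (0 : ℝ) 1) :
    HasDerivAt F (density F θ) θ :=
  (hF.differentiable θ (Ioo_subset_Icc_self hθ)).hasDerivWithinAt.hasDerivAt
    (Icc_mem_nhds hθ.1 hθ.2)

theorem RegularTypes.continuousOn_density (hF : RegularTypes F) : ContinuousOn (density F) Θ :=
  hF.density_differentiable.continuousOn

/-- Positivity is assumed only on [0,1); at 1, where the density may vanish, continuity gives the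
weak sign. -/
theorem RegularTypes.density_nonneg (hF : RegularTypes F) {θ : ℝ} (hθ : θ ∈ Θ) :
    0 ≤ density F θ := by
  rcases hθ.2.lt_or_eq with h | rfl
  · exact (hF.density_pos θ ⟨hθ.1, h⟩).le
  · have hc : ContinuousWithinAt (density F) (Ico 0 1) 1 :=
      (hF.continuousOn_density 1 hθ).mono Ico_subset_Icc_self
    have hne : (𝓝[Ico (0 : ℝ) 1] 1).NeBot := by
      rw [← mem_closure_iff_nhdsWithin_neBot, closure_Ico (by norm_num)]
      exact hθ
    exact ge_of_tendsto hc (eventually_mem_nhdsWithin.mono fun x hx => (hF.density_pos x hx).le)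

theorem RegularTypes.strictMonoOn (hF : RegularTypes F) : StrictMonoOn F Θ := by
  refine strictMonoOn_of_deriv_pos (convex_Icc 0 1) hF.differentiable.continuousOn fun x hx => ?_
  replace hx : x ∈ Ioo (0 : ℝ) 1 := by simpa [Θ] using hx
  rw [(hF.hasDerivAt hx).deriv]
  exact hF.density_pos x ⟨hx.1.le, hx.2⟩

theorem RegularTypes.le_one (hF : RegularTypes F) {θ : ℝ} (hθ : θ ∈ Θ) : F θ ≤ 1 := by
  rw [← hF.map_one]
  exact hF.strictMonoOn.monotoneOn hθ (right_mem_Icc.2 zero_le_one) hθ.2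

theorem RegularTypes.virtualValue_le (hF : RegularTypes F) {θ : ℝ} (hθ : θ ∈ Θ) :
    virtualValue F θ ≤ θ :=
  sub_le_self _ (div_nonneg (sub_nonneg.2 (hF.le_one hθ)) (hF.density_nonneg hθ))

theorem RegularTypes.virtualValue_one (hF : RegularTypes F) : virtualValue F 1 = 1 := by
  simp [virtualValue, hF.map_one]

theorem zero_mem_types : (0 : ℝ) ∈ Θ := left_mem_Icc.2 zero_le_one

theorem one_mem_types : (1 : ℝ) ∈ Θ := right_mem_Icc.2 zero_le_one

theorem measurableSet_types : MeasurableSet Θ := measurableSet_Icc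

/-- The virtual surplus times the density, without division. -/
theorem RegularTypes.virtualValue_mul_density (hF : RegularTypes F) {θ : ℝ} (hθ : θ ∈ Θ) :
    virtualValue F θ * density F θ = θ * density F θ - (1 - F θ) := by
  rcases hθ.2.lt_or_eq with h | rfl
  · have := (hF.density_pos θ ⟨hθ.1, h⟩).ne'
    rw [virtualValue]
    field_simp
  · simp [virtualValue, hF.map_one]

theorem RegularTypes.aemeasurable_density (hF : RegularTypes F) :
    AEMeasurable (fun θ => ENNReal.ofReal (density F θ)) (volume.restrict Θ) :=
  (hF.continuousOn_density.aemeasurable measurableSet_types).ennreal_ofReal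

theorem RegularTypes.integral_typeLaw (hF : RegularTypes F) (ψ : ℝ → ℝ) :
    ∫ θ, ψ θ ∂(typeLaw F) = ∫ θ in (0 : ℝ)..1, density F θ * ψ θ := by
  rw [typeLaw, integral_withDensity_eq_integral_toReal_smul₀ hF.aemeasurable_density
    (ae_of_all _ fun _ => ENNReal.ofReal_lt_top), intervalIntegral.integral_of_le zero_le_one,
    ← integral_Icc_eq_integral_Ioc]
  refine setIntegral_congr_fun measurableSet_types fun θ hθ => ?_
  simp [ENNReal.toReal_ofReal (hF.density_nonneg hθ)]

theorem RegularTypes.intervalIntegrable_density (hF : RegularTypes F) :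
    IntervalIntegrable (density F) volume 0 1 := by
  apply ContinuousOn.intervalIntegrable
  rw [uIcc_of_le zero_le_one]
  exact hF.continuousOn_density

theorem RegularTypes.isProbabilityMeasure (hF : RegularTypes F) :
    IsProbabilityMeasure (typeLaw F) := by
  constructor
  have h1 : ∫ θ in (0 : ℝ)..1, density F θ = 1 := by
    rw [intervalIntegral.integral_eq_sub_of_hasDerivAt_of_le zero_le_one
      hF.differentiable.continuousOn (fun x hx => hF.hasDerivAt hx) hF.intervalIntegrable_density,
      hF.map_one, hF.map_zero, sub_zero]
  rw [typeLaw, withDensity_apply _ MeasurableSet.univ, Measure.restrict_univ,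
    ← ofReal_integral_eq_lintegral_ofReal]
  · rw [Θ, integral_Icc_eq_integral_Ioc, ← intervalIntegral.integral_of_le zero_le_one, h1,
      ENNReal.ofReal_one]
  · exact hF.continuousOn_density.integrableOn_compact isCompact_Icc
  · exact (ae_restrict_mem measurableSet_types).mono fun θ hθ => hF.density_nonneg hθ

theorem typeLaw_absolutelyContinuous (F : ℝ → ℝ) : typeLaw F ≪ volume.restrict Θ :=
  withDensity_absolutelyContinuous _ _

theorem ae_typeLaw_mem (F : ℝ → ℝ) : ∀ᵐ θ ∂(typeLaw F), θ ∈ Θ :=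
  (typeLaw_absolutelyContinuous F).ae_le (ae_restrict_mem measurableSet_types)

/-- A strictly increasing function has at most one zero. That type has to be discarded because with
linear utility its virtual surplus is flat and the maximizer is not unique. -/
theorem RegularTypes.ae_virtualValue_ne_zero (hF : RegularTypes F) :
    ∀ᵐ θ ∂(typeLaw F), virtualValue F θ ≠ 0 := by
  have hs : {θ | θ ∈ Θ ∧ virtualValue F θ = 0}.Subsingleton := fun x hx y hy =>
    hF.virtualValue_strictMono.injOn hx.1 hy.1 (hx.2.trans hy.2.symm)
  have h0 : ∀ᵐ θ ∂(typeLaw F), ¬ (θ ∈ Θ ∧ virtualValue F θ = 0) := by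
    refine (typeLaw_absolutelyContinuous F).ae_le (ae_restrict_of_ae ?_)
    exact (measure_eq_zero_iff_ae_notMem (μ := volume)).1 (hs.measure_zero volume)
  filter_upwards [h0, ae_typeLaw_mem F] with θ h1 h2 h3
  exact h1 ⟨h2, h3⟩

theorem aemeasurable_typeLaw_of_monotoneOn {ψ : ℝ → ℝ} (hψ : MonotoneOn ψ Θ) (F : ℝ → ℝ) :
    AEMeasurable ψ (typeLaw F) :=
  (aemeasurable_restrict_of_monotoneOn measurableSet_types hψ).mono_ac
    (typeLaw_absolutelyContinuous F)

theorem RegularTypes.integrable_of_bound (hF : RegularTypes F) {ψ : ℝ → ℝ} {C : ℝ}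
    (hm : AEMeasurable ψ (typeLaw F)) (hC : ∀ θ ∈ Θ, |ψ θ| ≤ C) : Integrable ψ (typeLaw F) := by
  have := hF.isProbabilityMeasure
  exact Integrable.of_bound hm.aestronglyMeasurable C ((ae_typeLaw_mem F).mono hC)

theorem RegularTypes.integrable_of_monotoneOn (hF : RegularTypes F) {ψ : ℝ → ℝ}
    (hψ : MonotoneOn ψ Θ) : Integrable ψ (typeLaw F) := by
  refine hF.integrable_of_bound (aemeasurable_typeLaw_of_monotoneOn hψ F)
    (C := |ψ 0| + |ψ 1|) fun θ hθ => ?_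
  have h0 := hψ zero_mem_types hθ hθ.1
  have h1 := hψ hθ one_mem_types hθ.2
  have := neg_abs_le (ψ 0)
  have := le_abs_self (ψ 1)
  exact abs_le.2 ⟨by linarith [abs_nonneg (ψ 1)], by linarith [abs_nonneg (ψ 0)]⟩

/-- Products of monotone functions are integrable. -/
theorem RegularTypes.integrable_mul_of_monotoneOn (hF : RegularTypes F) {ψ χ : ℝ → ℝ}
    (hψ : MonotoneOn ψ Θ) (hχ : MonotoneOn χ Θ) :
    Integrable (fun θ => ψ θ * χ θ) (typeLaw F) := by
  refine (hF.integrable_of_monotoneOn hχ).bdd_mul (c := |ψ 0| + |ψ 1|)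
    (aemeasurable_typeLaw_of_monotoneOn hψ F).aestronglyMeasurable
    ((ae_typeLaw_mem F).mono fun θ hθ => ?_)
  have h0 := hψ zero_mem_types hθ hθ.1
  have h1 := hψ hθ one_mem_types hθ.2
  have := neg_abs_le (ψ 0)
  have := le_abs_self (ψ 1)
  exact abs_le.2 ⟨by linarith [abs_nonneg (ψ 1)], by linarith [abs_nonneg (ψ 0)]⟩

theorem RegularTypes.absolutelyContinuous_typeLaw (hF : RegularTypes F) :
    volume.restrict Θ ≪ typeLaw F := by
  refine withDensity_absolutelyContinuous' hF.aemeasurable_density ?_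
  have h1 : ∀ᵐ θ ∂(volume.restrict Θ), θ ≠ (1 : ℝ) :=
    ae_restrict_of_ae (Measure.ae_ne volume 1)
  filter_upwards [ae_restrict_mem measurableSet_types, h1] with θ hθ h
  simpa using hF.density_pos θ ⟨hθ.1, lt_of_le_of_ne hθ.2 h⟩

theorem RegularTypes.typeLaw_Icc_pos (hF : RegularTypes F) {ξ : ℝ} (hξ : ξ ∈ Ico (0 : ℝ) 1) :
    0 < (typeLaw F).real (Icc ξ 1) := by
  have := hF.isProbabilityMeasure
  refine ENNReal.toReal_pos (fun h0 => ?_) (measure_ne_top _ _)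
  have h2 := hF.absolutelyContinuous_typeLaw h0
  rw [Measure.restrict_apply measurableSet_Icc, Θ, Icc_inter_Icc, sup_eq_left.2 hξ.1, inf_idem,
    Real.volume_Icc, ENNReal.ofReal_eq_zero] at h2
  linarith [hξ.2]

/-- The derivative of the posted-price revenue θ(1 - F(θ)) is -φ(θ)F'(θ). This revenue is positive
at 1/2 and zero at 1, so by the mean value theorem φ is positive somewhere in between. Continuity of
φ at 1 cannot be invoked, since F'(1) may be 0. -/
theorem RegularTypes.exists_virtualValue_pos (hF : RegularTypes F) :
    ∃ ξ ∈ Ico (0 : ℝ) 1, 0 < virtualValue F ξ := by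
  obtain ⟨ξ, hξ, h⟩ := exists_hasDerivAt_eq_slope (fun θ => θ * (1 - F θ))
    (fun θ => 1 * (1 - F θ) + θ * (0 - density F θ)) (a := 1 / 2) (b := 1) (by norm_num)
    (continuousOn_id.mul (continuousOn_const.sub
      (hF.differentiable.continuousOn.mono (Icc_subset_Icc_left (by norm_num)))))
    (fun x hx => (hasDerivAt_id x).mul
      ((hasDerivAt_const x 1).sub (hF.hasDerivAt ⟨by linarith [hx.1], hx.2⟩)))
  have hξ0 : ξ ∈ Ico (0 : ℝ) 1 := ⟨by linarith [hξ.1], hξ.2⟩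
  refine ⟨ξ, hξ0, ?_⟩
  have hhalf : F (1 / 2) < 1 :=
    (hF.strictMonoOn ⟨by norm_num, by norm_num⟩ one_mem_types (by norm_num)).trans_eq hF.map_one
  rw [hF.map_one] at h
  have h3 := hF.virtualValue_mul_density (Ico_subset_Icc_self hξ0)
  have h4 := hF.density_pos ξ hξ0
  have : 0 < virtualValue F ξ * density F ξ := by
    rw [h3]
    have : (1 * (1 - 1) - 1 / 2 * (1 - F (1 / 2))) / (1 - 1 / 2) = -(1 - F (1/2)) := by ring
    linarith
  exact pos_of_mul_pos_left this h4.le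

end Types

/-! ### Concave utilities, regular or linear -/

/-- The properties shared by regular and linear utility: on the half-line the common term is null
at zero, nondecreasing, concave and continuous, and every negative linear perturbation of it has a
unique maximizer. -/
structure ConcaveUtility (g : ℝ → ℝ) : Prop where
  map_zero : g 0 = 0
  monotoneOn : MonotoneOn g (Ici 0)
  concaveOn : ConcaveOn ℝ (Ici 0) g
  continuousOn : ContinuousOn g (Ici 0)
  exists_maximizer : ∀ p < 0, ∃ b, 0 ≤ b ∧ ∀ q, 0 ≤ q → q ≠ b → g q + p * q < g b + p * b

theorem concaveUtility_linear : ConcaveUtility linearUtility where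
  map_zero := rfl
  monotoneOn := monotoneOn_const
  concaveOn := concaveOn_const 0 (convex_Ici 0)
  continuousOn := continuousOn_const
  exists_maximizer p hp := ⟨0, le_rfl, fun q hq hne => by
    have : 0 < q := lt_of_le_of_ne hq hne.symm
    simp only [linearUtility]
    nlinarith⟩

theorem RegularUtility.concaveUtility {g : ℝ → ℝ} (hg : RegularUtility g) :
    ConcaveUtility g where
  map_zero := hg.map_zero
  monotoneOn := hg.strictMono.monotoneOn
  concaveOn := hg.strictConcave.concaveOn
  continuousOn := hg.continuous
  exists_maximizer p hp := by
    -- By the Inada condition at infinity g'(z) < -p for some z > 0. Concavity then makes every q >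
    -- z worse than z, so the maximum over the compact interval [0, z] is global.
    obtain ⟨z, hz, hz1⟩ := ((hg.inada_top.eventually (gt_mem_nhds (neg_pos.2 hp))).and
      (eventually_gt_atTop 0)).exists
    have hcont : ContinuousOn (fun q => g q + p * q) (Icc 0 z) :=
      (hg.continuous.mono Icc_subset_Ici_self).add (continuousOn_const.mul continuousOn_id)
    obtain ⟨b, hb, hmax⟩ := isCompact_Icc.exists_isMaxOn ⟨0, le_rfl, hz1.le⟩ hcont
    have hconc : StrictConcaveOn ℝ (Ici 0) (fun q => g q + p * q) := by
      refine hg.strictConcave.add_concaveOn ⟨convex_Ici 0, fun x _ y _ a b _ _ _ => ?_⟩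
      simp only [smul_eq_mul]
      linarith
    have hall : ∀ q ∈ Ici (0 : ℝ), g q + p * q ≤ g b + p * b := by
      intro q hq
      rcases le_or_gt q z with h | h
      · exact hmax ⟨hq, h⟩
      · refine le_trans ?_ (hmax (right_mem_Icc.2 hz1.le))
        have hs := hg.strictConcave.concaveOn.slope_le_deriv (mem_Ici.2 hz1.le) hq h
          ((hg.differentiable z hz1).differentiableAt (Ioi_mem_nhds hz1))
        rw [slope_def_field, div_le_iff₀ (sub_pos.2 h)] at hs
        have : deriv g z * (q - z) ≤ -p * (q - z) :=
          mul_le_mul_of_nonneg_right hz.le (sub_pos.2 h).le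
        change g q + p * q ≤ g z + p * z
        linarith
    refine ⟨b, hb.1, fun q hq hne => lt_of_le_of_ne (hall q hq) fun heq => hne ?_⟩
    exact hconc.eq_of_isMaxOn (fun x hx => (hall x hx).trans_eq heq.symm) hall hq hb.1

/-! ### Pointwise maximization of the virtual surplus under a cap -/

/-- The virtual-surplus maximizer truncated at `x`. -/
noncomputable def truncatedMaximizer (F g : ℝ → ℝ) (x θ : ℝ) : ℝ :=
  (min (virtualMaximizer F g θ) (ENNReal.ofReal x)).toReal

/-- The virtual surplus of quality `q` for type `θ`. -/
noncomputable def virtualSurplus (F g : ℝ → ℝ) (q θ : ℝ) : ℝ := g q + virtualValue F θ * q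

section Pointwise
variable {F g : ℝ → ℝ}

theorem truncatedMaximizer_of_nonneg {x θ : ℝ} (hθ : 0 ≤ virtualValue F θ) (hx : 0 ≤ x) :
    truncatedMaximizer F g x θ = x := by
  simp [truncatedMaximizer, virtualMaximizer, hθ, ENNReal.toReal_ofReal hx]

theorem virtualMaximizer_of_neg {b θ : ℝ} (hθ : virtualValue F θ < 0) (hb : 0 ≤ b)
    (h : ∀ q, 0 ≤ q → q ≠ b → g q + virtualValue F θ * q < g b + virtualValue F θ * b) :
    virtualMaximizer F g θ = ENNReal.ofReal b := by
  rw [virtualMaximizer, if_neg (not_le.2 hθ)]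
  have : {q | 0 ≤ q ∧ ∀ q', 0 ≤ q' →
      g q' + virtualValue F θ * q' ≤ g q + virtualValue F θ * q} = {b} := by
    ext q
    refine ⟨fun hq => ?_, ?_⟩
    · by_contra hne
      exact absurd (hq.2 b hb) (not_le.2 (h q hq.1 hne))
    · rintro rfl
      refine ⟨hb, fun q' hq' => ?_⟩
      rcases eq_or_ne q' q with rfl | hne
      · exact le_rfl
      · exact (h q' hq' hne).le
  rw [this, image_singleton, sSup_singleton]

theorem truncatedMaximizer_of_neg {b x θ : ℝ} (hθ : virtualValue F θ < 0) (hb : 0 ≤ b)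
    (h : ∀ q, 0 ≤ q → q ≠ b → g q + virtualValue F θ * q < g b + virtualValue F θ * b)
    (hx : 0 ≤ x) : truncatedMaximizer F g x θ = min b x := by
  rw [truncatedMaximizer, virtualMaximizer_of_neg hθ hb h, ← ENNReal.ofReal_min,
    ENNReal.toReal_ofReal (le_min hb hx)]

theorem truncatedMaximizer_nonneg (F g : ℝ → ℝ) (x θ : ℝ) : 0 ≤ truncatedMaximizer F g x θ :=
  ENNReal.toReal_nonneg

theorem truncatedMaximizer_le {x θ : ℝ} (hx : 0 ≤ x) : truncatedMaximizer F g x θ ≤ x := by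
  rw [truncatedMaximizer, ← ENNReal.toReal_ofReal hx]
  refine ENNReal.toReal_mono ENNReal.ofReal_ne_top ?_
  rw [ENNReal.toReal_ofReal hx]
  exact min_le_right _ _

/-- Truncation in terms of a single real number, valid up to a given level. -/
theorem truncatedMaximizer_eq_min {x y θ : ℝ} (hx : 0 ≤ x) (hxy : x ≤ y) :
    truncatedMaximizer F g x θ = min (truncatedMaximizer F g y θ) x := by
  have hle := ENNReal.ofReal_le_ofReal hxy
  have h1 : min (virtualMaximizer F g θ) (ENNReal.ofReal x) =
      min (min (virtualMaximizer F g θ) (ENNReal.ofReal y)) (ENNReal.ofReal x) := by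
    rw [min_assoc, min_eq_right hle]
  rw [truncatedMaximizer, h1, truncatedMaximizer]
  nth_rewrite 2 [← ENNReal.toReal_ofReal hx]
  exact ENNReal.toReal_min (ne_top_of_le_ne_top ENNReal.ofReal_ne_top (min_le_right _ _))
    ENNReal.ofReal_ne_top

theorem truncatedMaximizer_mono {x y θ : ℝ} (hx : 0 ≤ x) (hxy : x ≤ y) :
    truncatedMaximizer F g x θ ≤ truncatedMaximizer F g y θ := by
  rw [truncatedMaximizer_eq_min hx hxy]
  exact min_le_left _ _

theorem competitiveAllocation_eq (F g : ℝ → ℝ) (x y θ : ℝ) :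
    competitiveAllocation F g x y θ = max (truncatedMaximizer F g x θ) y := rfl

/-- For φ > 0 the virtual surplus is strictly increasing, so the cap is optimal. For φ < 0 it has a
unique peak b, and if the cap lies below b, concavity makes the cap strictly better than anything
lower. -/
theorem ConcaveUtility.virtualSurplus_lt (hg : ConcaveUtility g) {x q θ : ℝ}
    (hθ : virtualValue F θ ≠ 0) (hq : 0 ≤ q) (hqx : q ≤ x)
    (hne : q ≠ truncatedMaximizer F g x θ) :
    virtualSurplus F g q θ < virtualSurplus F g (truncatedMaximizer F g x θ) θ := by
  have hx := hq.trans hqx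
  rcases lt_or_gt_of_ne hθ with h | h
  · obtain ⟨b, hb, hmax⟩ := hg.exists_maximizer _ h
    rw [truncatedMaximizer_of_neg h hb hmax hx] at hne ⊢
    rcases le_total b x with hbx | hbx
    · rw [min_eq_left hbx] at hne ⊢
      exact hmax q hq hne
    · rw [min_eq_right hbx] at hne ⊢
      have hlt := lt_of_le_of_ne hqx hne
      have hqb := hlt.trans_le hbx
      have h1 := hmax q hq hqb.ne
      have hconc : ConcaveOn ℝ (Ici 0) (fun q => g q + virtualValue F θ * q) := by
        refine hg.concaveOn.add ⟨convex_Ici 0, fun x _ y _ a b _ _ _ => ?_⟩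
        simp only [smul_eq_mul]
        linarith
      rcases hbx.lt_or_eq with hbx | rfl
      -- The cap x is a convex combination of q and b with positive weight on b. The value at b
      -- exceeds that at q, so concavity puts the value at x above that at q.
      · by_contra! hcon
        have := hconc.2 (mem_Ici.2 hq) (mem_Ici.2 hb)
          (div_nonneg (sub_nonneg.2 hbx.le) (sub_pos.2 hqb).le)
          (div_nonneg (sub_nonneg.2 hlt.le) (sub_pos.2 hqb).le)
          (by rw [← add_div, sub_add_sub_cancel, div_self (sub_pos.2 hqb).ne'])
        have hpt : ((b - x) / (b - q)) • q + ((x - q) / (b - q)) • b = x := by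
          have := (sub_pos.2 hqb).ne'
          simp only [smul_eq_mul]
          field_simp
          ring
        rw [hpt] at this
        have h0 : 0 < (x - q) / (b - q) := div_pos (sub_pos.2 hlt) (sub_pos.2 hqb)
        have h2 : (b - x) / (b - q) = 1 - (x - q) / (b - q) := by
          have := (sub_pos.2 hqb).ne'
          field_simp
          ring
        rw [h2] at this
        simp only [smul_eq_mul, virtualSurplus] at this hcon
        nlinarith
      · exact h1
  · rw [truncatedMaximizer_of_nonneg h.le hx] at hne ⊢
    have := hg.monotoneOn hq hx hqx
    have := mul_lt_mul_of_pos_left (lt_of_le_of_ne hqx hne) h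
    simp only [virtualSurplus]
    linarith

theorem ConcaveUtility.virtualSurplus_le (hg : ConcaveUtility g) {x q θ : ℝ}
    (hq : 0 ≤ q) (hqx : q ≤ x) :
    virtualSurplus F g q θ ≤ virtualSurplus F g (truncatedMaximizer F g x θ) θ := by
  rcases eq_or_ne (virtualValue F θ) 0 with h | h
  · rw [truncatedMaximizer_of_nonneg h.ge (hq.trans hqx), virtualSurplus, virtualSurplus, h]
    linarith [hg.monotoneOn hq (hq.trans hqx : (0 : ℝ) ≤ x) hqx]
  · rcases eq_or_ne q (truncatedMaximizer F g x θ) with h1 | h1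
    · rw [← h1]
    · exact (hg.virtualSurplus_lt h hq hqx h1).le

/-- Revealed preference: if the peaks were reversed, adding the two strict optimality inequalities
would contradict the order of the virtual values. -/
theorem ConcaveUtility.truncatedMaximizer_monotoneOn (hF : RegularTypes F)
    (hg : ConcaveUtility g) {x : ℝ} (hx : 0 ≤ x) :
    MonotoneOn (truncatedMaximizer F g x) Θ := by
  intro θ hθ θ' hθ' hle
  rcases le_or_gt 0 (virtualValue F θ') with h' | h'
  · rw [truncatedMaximizer_of_nonneg h' hx]
    exact truncatedMaximizer_le hx
  · have hp := hF.virtualValue_strictMono.monotoneOn hθ hθ' hle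
    have h := hp.trans_lt h'
    obtain ⟨b, hb, hmax⟩ := hg.exists_maximizer _ h
    obtain ⟨b', hb', hmax'⟩ := hg.exists_maximizer _ h'
    rw [truncatedMaximizer_of_neg h hb hmax hx, truncatedMaximizer_of_neg h' hb' hmax' hx]
    refine min_le_min_right x ?_
    by_contra! hlt
    have h1 := hmax b' hb' hlt.ne
    have h2 := hmax' b hb hlt.ne'
    nlinarith

/-- The value of a concave program is concave in its constraint: the mixture of the optima for two
caps is feasible for the mixed cap. -/
theorem virtualSurplus_truncatedMaximizer_concave (F : ℝ → ℝ) (hg : ConcaveUtility g) (θ : ℝ) :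
    ConcaveOn ℝ (Ici 0) fun x => virtualSurplus F g (truncatedMaximizer F g x θ) θ := by
  refine ⟨convex_Ici 0, fun x hx y hy a b ha hb hab => ?_⟩
  have hx0 : 0 ≤ x := hx
  have hy0 : 0 ≤ y := hy
  have hBx := truncatedMaximizer_nonneg F g x θ
  have hBy := truncatedMaximizer_nonneg F g y θ
  have h1 := hg.concaveOn.2 (mem_Ici.2 hBx) (mem_Ici.2 hBy) ha hb hab
  refine le_trans ?_ (hg.virtualSurplus_le (F := F) (θ := θ)
    (q := a • truncatedMaximizer F g x θ + b • truncatedMaximizer F g y θ) (by positivity) ?_)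
  · simp only [virtualSurplus, smul_eq_mul] at h1 ⊢
    nlinarith
  · simp only [smul_eq_mul]
    exact add_le_add (mul_le_mul_of_nonneg_left (truncatedMaximizer_le hx0) ha)
      (mul_le_mul_of_nonneg_left (truncatedMaximizer_le hy0) hb)

/-- Concave functions have decreasing increments, in the form used for truncations. -/
theorem ConcaveUtility.min_sub_min_le (hg : ConcaveUtility g) {b x y : ℝ}
    (hx : 0 ≤ x) (hxy : x ≤ y) : g (min b y) - g (min b x) ≤ g y - g x := by
  have hm := hg.monotoneOn (mem_Ici.2 hx) (mem_Ici.2 (hx.trans hxy)) hxy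
  rcases le_total b x with h | h
  · rw [min_eq_left h, min_eq_left (h.trans hxy)]
    linarith
  · rw [min_eq_right h]
    have : g (min b y) ≤ g y := hg.monotoneOn (mem_Ici.2 (le_min (hx.trans h) (hx.trans hxy)))
      (mem_Ici.2 (hx.trans hxy)) (min_le_right _ _)
    linarith

end Pointwise

/-! ### Revenue, surplus, rent and floor gain as functions of the cap -/

/-- Aggregate utility from the allocation that truncates the virtual-surplus maximizer at `x`. -/
noncomputable def truncatedSurplus (F g : ℝ → ℝ) (x : ℝ) : ℝ :=
  grossSurplus F g (truncatedMaximizer F g x)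

/-- The gain in aggregate utility from raising the truncated maximizer to the floor `y`. -/
noncomputable def floorGain (F g : ℝ → ℝ) (y : ℝ) : ℝ :=
  ∫ θ, (utility g y θ - utility g (truncatedMaximizer F g y θ) θ) ∂(typeLaw F)

/-- The aggregate information rent from the allocation truncated at `x`. -/
noncomputable def informationRent (F g : ℝ → ℝ) (x : ℝ) : ℝ :=
  ∫ θ, (θ - virtualValue F θ) * truncatedMaximizer F g x θ ∂(typeLaw F)

section Integrals
variable {F g : ℝ → ℝ}

theorem ConcaveUtility.comp_monotoneOn (hg : ConcaveUtility g) {A : ℝ → ℝ}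
    (hA : MonotoneOn A Θ) (h0 : ∀ θ ∈ Θ, 0 ≤ A θ) : MonotoneOn (fun θ => g (A θ)) Θ :=
  fun _ hx _ hy hxy => hg.monotoneOn (h0 _ hx) (h0 _ hy) (hA hx hy hxy)

theorem ConcaveUtility.integrable_utility (hF : RegularTypes F) (hg : ConcaveUtility g)
    {A : ℝ → ℝ} (hA : MonotoneOn A Θ) (h0 : ∀ θ ∈ Θ, 0 ≤ A θ) :
    Integrable (fun θ => utility g (A θ) θ) (typeLaw F) :=
  (hF.integrable_of_monotoneOn (hg.comp_monotoneOn hA h0)).add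
    (hF.integrable_mul_of_monotoneOn monotoneOn_id hA)

theorem ConcaveUtility.integrable_virtualSurplus (hF : RegularTypes F) (hg : ConcaveUtility g)
    {A : ℝ → ℝ} (hA : MonotoneOn A Θ) (h0 : ∀ θ ∈ Θ, 0 ≤ A θ) :
    Integrable (fun θ => virtualSurplus F g (A θ) θ) (typeLaw F) :=
  (hF.integrable_of_monotoneOn (hg.comp_monotoneOn hA h0)).add
    (hF.integrable_mul_of_monotoneOn hF.virtualValue_strictMono.monotoneOn hA)

theorem RegularTypes.integrable_rent (hF : RegularTypes F) {A : ℝ → ℝ} (hA : MonotoneOn A Θ) :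
    Integrable (fun θ => (θ - virtualValue F θ) * A θ) (typeLaw F) := by
  simp only [sub_mul]
  exact (hF.integrable_mul_of_monotoneOn monotoneOn_id hA).sub
    (hF.integrable_mul_of_monotoneOn hF.virtualValue_strictMono.monotoneOn hA)

theorem ConcaveUtility.integrable_utility_truncated (hF : RegularTypes F) (hg : ConcaveUtility g)
    {x : ℝ} (hx : 0 ≤ x) :
    Integrable (fun θ => utility g (truncatedMaximizer F g x θ) θ) (typeLaw F) :=
  hg.integrable_utility hF (hg.truncatedMaximizer_monotoneOn hF hx)
    fun θ _ => truncatedMaximizer_nonneg F g x θ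

theorem ConcaveUtility.integrable_virtualSurplus_truncated (hF : RegularTypes F)
    (hg : ConcaveUtility g) {x : ℝ} (hx : 0 ≤ x) :
    Integrable (fun θ => virtualSurplus F g (truncatedMaximizer F g x θ) θ) (typeLaw F) :=
  hg.integrable_virtualSurplus hF (hg.truncatedMaximizer_monotoneOn hF hx)
    fun θ _ => truncatedMaximizer_nonneg F g x θ

theorem ConcaveUtility.integrable_utility_const (hF : RegularTypes F) (hg : ConcaveUtility g)
    {x : ℝ} (hx : 0 ≤ x) : Integrable (fun θ => utility g x θ) (typeLaw F) :=
  hg.integrable_utility hF (A := fun _ => x) monotoneOn_const fun _ _ => hx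

theorem ConcaveUtility.integrable_floorGain (hF : RegularTypes F) (hg : ConcaveUtility g)
    {x : ℝ} (hx : 0 ≤ x) :
    Integrable (fun θ => utility g x θ - utility g (truncatedMaximizer F g x θ) θ) (typeLaw F) :=
  (hg.integrable_utility_const hF hx).sub (hg.integrable_utility_truncated hF hx)

theorem measurable_domRestrict_of_monotoneOn {A : ℝ → ℝ} (hA : MonotoneOn A Θ) :
    Measurable (Θ.domRestrict A) := by
  have : Monotone (Θ.domRestrict A) := fun x y hxy => hA x.2 y.2 hxy
  exact this.measurable

theorem ConcaveUtility.isAllocation_truncated (hF : RegularTypes F) (hg : ConcaveUtility g)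
    {x : ℝ} (hx : 0 ≤ x) : IsAllocation (truncatedMaximizer F g x) :=
  ⟨measurable_domRestrict_of_monotoneOn (hg.truncatedMaximizer_monotoneOn hF hx),
    fun θ _ => truncatedMaximizer_nonneg F g x θ⟩

theorem ConcaveUtility.integral_virtualSurplus_le (hF : RegularTypes F) (hg : ConcaveUtility g)
    {A : ℝ → ℝ} (hA : MonotoneOn A Θ) (h0 : ∀ θ ∈ Θ, 0 ≤ A θ) {x : ℝ} (hx : 0 ≤ x)
    (hAx : ∀ θ ∈ Θ, A θ ≤ x) :
    ∫ θ, virtualSurplus F g (A θ) θ ∂(typeLaw F) ≤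
      ∫ θ, virtualSurplus F g (truncatedMaximizer F g x θ) θ ∂(typeLaw F) :=
  integral_mono_ae (hg.integrable_virtualSurplus hF hA h0)
    (hg.integrable_virtualSurplus_truncated hF hx)
    ((ae_typeLaw_mem F).mono fun θ hθ => hg.virtualSurplus_le (h0 θ hθ) (hAx θ hθ))

/-- The monotonicity constraint does not bind, because the pointwise maximizer is already
nondecreasing. -/
theorem ConcaveUtility.revenue_eq (hF : RegularTypes F) (hg : ConcaveUtility g)
    {x : ℝ} (hx : 0 ≤ x) :
    revenue F g x = ∫ θ, virtualSurplus F g (truncatedMaximizer F g x θ) θ ∂(typeLaw F) := by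
  refine IsGreatest.csSup_eq ⟨⟨_, hg.isAllocation_truncated hF hx,
    hg.truncatedMaximizer_monotoneOn hF hx, fun θ _ => truncatedMaximizer_le hx, rfl⟩, ?_⟩
  rintro _ ⟨A, hA, hmono, hle, rfl⟩
  exact hg.integral_virtualSurplus_le hF hmono hA.2 hx hle

theorem ConcaveUtility.truncatedSurplus_eq (hF : RegularTypes F) (hg : ConcaveUtility g)
    {x : ℝ} (hx : 0 ≤ x) :
    truncatedSurplus F g x = revenue F g x + informationRent F g x := by
  rw [hg.revenue_eq hF hx, informationRent, ← integral_add
    (hg.integrable_virtualSurplus_truncated hF hx)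
    (hF.integrable_rent (hg.truncatedMaximizer_monotoneOn hF hx))]
  refine integral_congr_ae (ae_of_all _ fun θ => ?_)
  simp only [utility, virtualSurplus]
  ring

theorem utility_mono (hg : ConcaveUtility g) {θ q q' : ℝ} (hθ : θ ∈ Θ) (hq : 0 ≤ q)
    (hqq : q ≤ q') : utility g q θ ≤ utility g q' θ :=
  add_le_add (hg.monotoneOn hq (hq.trans hqq : (0 : ℝ) ≤ q') hqq)
    (mul_le_mul_of_nonneg_left hqq hθ.1)

/-- A type whose truncated choice is at least y is unaffected by the floor and contributes nothing
to the gain; any other type is lifted from its unconstrained choice to y, whatever x is. This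
decouples the two caps. -/
theorem ConcaveUtility.grossSurplus_competitive (hF : RegularTypes F) (hg : ConcaveUtility g)
    {x y : ℝ} (hy : 0 ≤ y) (hyx : y ≤ x) :
    grossSurplus F g (competitiveAllocation F g x y) =
      truncatedSurplus F g x + floorGain F g y := by
  rw [truncatedSurplus, grossSurplus, grossSurplus, floorGain, ← integral_add
    (hg.integrable_utility_truncated hF (hy.trans hyx)) (hg.integrable_floorGain hF hy)]
  refine integral_congr_ae (ae_of_all _ fun θ => ?_)
  simp only [competitiveAllocation_eq]
  rw [truncatedMaximizer_eq_min (F := F) (g := g) (θ := θ) hy hyx]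
  rcases le_total (truncatedMaximizer F g x θ) y with h | h
  · rw [max_eq_right h, min_eq_left h]
    ring
  · rw [max_eq_left h, min_eq_right h]
    ring

theorem topQuality_of_monotoneOn {A : ℝ → ℝ} (hA : MonotoneOn A Θ) : topQuality A = A 1 :=
  IsGreatest.csSup_eq ⟨mem_image_of_mem _ one_mem_types, by
    rintro _ ⟨θ, hθ, rfl⟩
    exact hA hθ one_mem_types hθ.2⟩

theorem RegularTypes.truncatedMaximizer_one (hF : RegularTypes F) (g : ℝ → ℝ) {x : ℝ}
    (hx : 0 ≤ x) : truncatedMaximizer F g x 1 = x :=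
  truncatedMaximizer_of_nonneg (by rw [hF.virtualValue_one]; exact zero_le_one) hx

theorem ConcaveUtility.topQuality_truncated (hF : RegularTypes F) (hg : ConcaveUtility g)
    {x : ℝ} (hx : 0 ≤ x) : topQuality (truncatedMaximizer F g x) = x := by
  rw [topQuality_of_monotoneOn (hg.truncatedMaximizer_monotoneOn hF hx),
    hF.truncatedMaximizer_one g hx]

theorem ConcaveUtility.topQuality_competitive (hF : RegularTypes F) (hg : ConcaveUtility g)
    {x y : ℝ} (hy : 0 ≤ y) (hyx : y ≤ x) : topQuality (competitiveAllocation F g x y) = x := by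
  have hx := hy.trans hyx
  rw [topQuality_of_monotoneOn (A := competitiveAllocation F g x y), competitiveAllocation_eq,
    hF.truncatedMaximizer_one g hx, max_eq_left hyx]
  intro θ hθ θ' hθ' h
  simp only [competitiveAllocation_eq]
  exact max_le_max_right y (hg.truncatedMaximizer_monotoneOn hF hx hθ hθ' h)

theorem ConcaveUtility.informationRent_monotoneOn (hF : RegularTypes F) (hg : ConcaveUtility g) :
    MonotoneOn (informationRent F g) (Ici 0) := by
  intro x hx y hy hxy
  refine integral_mono_ae (hF.integrable_rent (hg.truncatedMaximizer_monotoneOn hF hx))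
    (hF.integrable_rent (hg.truncatedMaximizer_monotoneOn hF hy))
    ((ae_typeLaw_mem F).mono fun θ hθ => ?_)
  exact mul_le_mul_of_nonneg_left (truncatedMaximizer_mono hx hxy)
    (sub_nonneg.2 (hF.virtualValue_le hθ))

/-- For each type, raising the level from x to y increases the utility of the constant quality by at
least as much as that of the truncated choice. -/
theorem ConcaveUtility.floorGain_monotoneOn (hF : RegularTypes F) (hg : ConcaveUtility g) :
    MonotoneOn (floorGain F g) (Ici 0) := by
  intro x hx y hy hxy
  have hx0 : 0 ≤ x := hx
  refine integral_mono_ae (hg.integrable_floorGain hF hx) (hg.integrable_floorGain hF hy)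
    ((ae_typeLaw_mem F).mono fun θ hθ => ?_)
  simp only [utility, truncatedMaximizer_eq_min (F := F) (g := g) (θ := θ) hx hxy]
  have hle := truncatedMaximizer_le (F := F) (g := g) (θ := θ) (x := y) hy
  have h1 := hg.min_sub_min_le (b := truncatedMaximizer F g y θ) hx hxy
  rw [min_eq_left hle] at h1
  have h2 : truncatedMaximizer F g y θ - min (truncatedMaximizer F g y θ) x ≤ y - x := by
    rcases le_total (truncatedMaximizer F g y θ) x with h | h
    · rw [min_eq_left h]; linarith
    · rw [min_eq_right h]; linarith
  have h3 := mul_le_mul_of_nonneg_left h2 hθ.1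
  linarith

theorem ConcaveUtility.revenue_monotoneOn (hF : RegularTypes F) (hg : ConcaveUtility g) :
    MonotoneOn (revenue F g) (Ici 0) := by
  intro x hx y hy hxy
  rw [hg.revenue_eq hF hx, hg.revenue_eq hF hy]
  exact hg.integral_virtualSurplus_le hF (hg.truncatedMaximizer_monotoneOn hF hx)
    (fun θ _ => truncatedMaximizer_nonneg F g x θ) hy
    fun θ _ => (truncatedMaximizer_le hx).trans hxy

theorem ConcaveUtility.revenue_concaveOn (hF : RegularTypes F) (hg : ConcaveUtility g) :
    ConcaveOn ℝ (Ici 0) (revenue F g) := by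
  refine ⟨convex_Ici 0, fun x hx y hy a b ha hb hab => ?_⟩
  have hxy : a • x + b • y ∈ Ici (0 : ℝ) := convex_Ici (0 : ℝ) hx hy ha hb hab
  rw [hg.revenue_eq hF hx, hg.revenue_eq hF hy, hg.revenue_eq hF hxy, smul_eq_mul, smul_eq_mul,
    ← integral_const_mul, ← integral_const_mul, ← integral_add
    ((hg.integrable_virtualSurplus_truncated hF hx).const_mul a)
    ((hg.integrable_virtualSurplus_truncated hF hy).const_mul b)]
  exact integral_mono (((hg.integrable_virtualSurplus_truncated hF hx).const_mul a).add
    ((hg.integrable_virtualSurplus_truncated hF hy).const_mul b))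
    (hg.integrable_virtualSurplus_truncated hF hxy)
    fun θ => (virtualSurplus_truncatedMaximizer_concave F hg θ).2 hx hy ha hb hab

/-- Types above some ξ with φ(ξ) > 0 consume the whole cap and gain at least φ(ξ) per unit; they
have positive mass, and no other type loses. -/
theorem ConcaveUtility.revenue_strictMonoOn (hF : RegularTypes F) (hg : ConcaveUtility g) :
    StrictMonoOn (revenue F g) (Ici 0) := by
  intro x hx y hy hxy
  have := hF.isProbabilityMeasure
  obtain ⟨ξ, hξ, hpos⟩ := hF.exists_virtualValue_pos
  rw [hg.revenue_eq hF hx, hg.revenue_eq hF hy, ← sub_pos, ← integral_sub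
    (hg.integrable_virtualSurplus_truncated hF hy) (hg.integrable_virtualSurplus_truncated hF hx)]
  have hlow : 0 < ∫ θ, (Icc ξ 1).indicator (fun _ => virtualValue F ξ * (y - x)) θ
      ∂(typeLaw F) := by
    rw [integral_indicator measurableSet_Icc, setIntegral_const, smul_eq_mul]
    exact mul_pos (hF.typeLaw_Icc_pos hξ) (mul_pos hpos (sub_pos.2 hxy))
  refine hlow.trans_le (integral_mono_ae ((integrable_const _).indicator measurableSet_Icc)
    ((hg.integrable_virtualSurplus_truncated hF hy).sub
      (hg.integrable_virtualSurplus_truncated hF hx)) ((ae_typeLaw_mem F).mono fun θ hθ => ?_))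
  by_cases h : θ ∈ Icc ξ 1
  · simp only [indicator_of_mem h]
    have h1 := hF.virtualValue_strictMono.monotoneOn (Ico_subset_Icc_self hξ) hθ h.1
    rw [truncatedMaximizer_of_nonneg (hpos.le.trans h1) hx,
      truncatedMaximizer_of_nonneg (hpos.le.trans h1) hy, virtualSurplus, virtualSurplus]
    have h2 := hg.monotoneOn hx hy hxy.le
    have h3 := mul_le_mul_of_nonneg_right h1 (sub_pos.2 hxy).le
    linarith
  · simp only [indicator_of_notMem h]
    exact sub_nonneg.2 (hg.virtualSurplus_le (truncatedMaximizer_nonneg F g x θ)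
      ((truncatedMaximizer_le hx).trans hxy.le))

/-- A modulus of continuity: increments are dominated by those of q ↦ g(q) + q, the utility of type
1. A Lipschitz bound would fail at 0, where g' may be infinite. -/
theorem ConcaveUtility.truncatedSurplus_sub_le (hF : RegularTypes F) (hg : ConcaveUtility g)
    {x y : ℝ} (hx : 0 ≤ x) (hxy : x ≤ y) :
    truncatedSurplus F g y - truncatedSurplus F g x ≤ (g y + y) - (g x + x) := by
  have := hF.isProbabilityMeasure
  have hy := hx.trans hxy
  rw [truncatedSurplus, truncatedSurplus, grossSurplus, grossSurplus, ← integral_sub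
    (hg.integrable_utility_truncated hF hy) (hg.integrable_utility_truncated hF hx)]
  have hc : (g y + y) - (g x + x) = ∫ _, ((g y + y) - (g x + x)) ∂(typeLaw F) := by simp
  rw [hc]
  refine integral_mono_ae ((hg.integrable_utility_truncated hF hy).sub
    (hg.integrable_utility_truncated hF hx)) (integrable_const _)
    ((ae_typeLaw_mem F).mono fun θ hθ => ?_)
  simp only [utility, truncatedMaximizer_eq_min (F := F) (g := g) (θ := θ) hx hxy]
  have hle := truncatedMaximizer_le (F := F) (g := g) (θ := θ) (x := y) hy
  have h1 := hg.min_sub_min_le (b := truncatedMaximizer F g y θ) hx hxy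
  rw [min_eq_left hle] at h1
  have h2 : truncatedMaximizer F g y θ - min (truncatedMaximizer F g y θ) x ≤ y - x := by
    rcases le_total (truncatedMaximizer F g y θ) x with h | h
    · rw [min_eq_left h]; linarith
    · rw [min_eq_right h]; linarith
  have h3 := mul_le_mul_of_nonneg_left h2 hθ.1
  have h4 := mul_le_mul_of_nonneg_right hθ.2 (sub_nonneg.2 hxy)
  linarith

theorem ConcaveUtility.floorGain_sub_le (hF : RegularTypes F) (hg : ConcaveUtility g)
    {x y : ℝ} (hx : 0 ≤ x) (hxy : x ≤ y) :
    floorGain F g y - floorGain F g x ≤ (g y + y) - (g x + x) := by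
  have := hF.isProbabilityMeasure
  have hy := hx.trans hxy
  have hix := hg.integrable_floorGain hF hx
  have hiy := hg.integrable_floorGain hF hy
  rw [floorGain, floorGain, ← integral_sub hiy hix]
  have hc : (g y + y) - (g x + x) = ∫ _, ((g y + y) - (g x + x)) ∂(typeLaw F) := by simp
  rw [hc]
  refine integral_mono_ae (hiy.sub hix) (integrable_const _)
    ((ae_typeLaw_mem F).mono fun θ hθ => ?_)
  have h1 := utility_mono hg hθ (truncatedMaximizer_nonneg F g x θ)
    (truncatedMaximizer_mono (g := g) hx hxy)
  have h4 := mul_le_mul_of_nonneg_right hθ.2 (sub_nonneg.2 hxy)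
  simp only [utility] at h1 ⊢
  linarith

theorem ConcaveUtility.revenue_sub_le (hF : RegularTypes F) (hg : ConcaveUtility g)
    {x y : ℝ} (hx : 0 ≤ x) (hxy : x ≤ y) :
    revenue F g y - revenue F g x ≤ (g y + y) - (g x + x) := by
  have h1 := hg.truncatedSurplus_sub_le hF hx hxy
  rw [hg.truncatedSurplus_eq hF hx, hg.truncatedSurplus_eq hF (hx.trans hxy)] at h1
  have := hg.informationRent_monotoneOn hF hx (hx.trans hxy) hxy
  linarith

theorem ConcaveUtility.truncatedSurplus_monotoneOn (hF : RegularTypes F) (hg : ConcaveUtility g) :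
    MonotoneOn (truncatedSurplus F g) (Ici 0) := by
  intro x hx y hy hxy
  rw [hg.truncatedSurplus_eq hF hx, hg.truncatedSurplus_eq hF hy]
  exact add_le_add (hg.revenue_monotoneOn hF hx hy hxy)
    (hg.informationRent_monotoneOn hF hx hy hxy)

theorem ConcaveUtility.continuousOn_of_sub_le (hg : ConcaveUtility g) {ψ : ℝ → ℝ}
    (hm : MonotoneOn ψ (Ici 0))
    (h : ∀ x y, 0 ≤ x → x ≤ y → ψ y - ψ x ≤ (g y + y) - (g x + x)) :
    ContinuousOn ψ (Ici 0) := by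
  have key : ∀ x ∈ Ici (0 : ℝ), ∀ y ∈ Ici (0 : ℝ), |ψ y - ψ x| ≤ |(g y + y) - (g x + x)| := by
    intro x hx y hy
    rcases le_total x y with hxy | hxy
    · rw [abs_of_nonneg (sub_nonneg.2 (hm hx hy hxy))]
      exact (h x y hx hxy).trans (le_abs_self _)
    · rw [abs_sub_comm, abs_of_nonneg (sub_nonneg.2 (hm hy hx hxy)), abs_sub_comm (g y + y)]
      exact (h y x hy hxy).trans (le_abs_self _)
  intro x hx
  have hG : ContinuousWithinAt (fun y => |(g y + y) - (g x + x)|) (Ici 0) x :=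
    (((hg.continuousOn x hx).add continuousWithinAt_id).sub continuousWithinAt_const).abs
  have hG0 : Tendsto (fun y => |(g y + y) - (g x + x)|) (𝓝[Ici 0] x) (𝓝 0) := by
    simpa [ContinuousWithinAt] using hG
  refine tendsto_iff_dist_tendsto_zero.2 (squeeze_zero' (Eventually.of_forall fun _ => dist_nonneg)
    (eventually_mem_nhdsWithin.mono fun y hy => ?_) hG0)
  rw [Real.dist_eq]
  exact key x hx y hy

theorem ConcaveUtility.revenue_continuousOn (hF : RegularTypes F) (hg : ConcaveUtility g) :
    ContinuousOn (revenue F g) (Ici 0) :=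
  hg.continuousOn_of_sub_le (hg.revenue_monotoneOn hF) fun _ _ => hg.revenue_sub_le hF

theorem ConcaveUtility.truncatedSurplus_continuousOn (hF : RegularTypes F)
    (hg : ConcaveUtility g) : ContinuousOn (truncatedSurplus F g) (Ici 0) :=
  hg.continuousOn_of_sub_le (hg.truncatedSurplus_monotoneOn hF)
    fun _ _ => hg.truncatedSurplus_sub_le hF

theorem ConcaveUtility.floorGain_continuousOn (hF : RegularTypes F) (hg : ConcaveUtility g) :
    ContinuousOn (floorGain F g) (Ici 0) :=
  hg.continuousOn_of_sub_le (hg.floorGain_monotoneOn hF) fun _ _ => hg.floorGain_sub_le hF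

theorem truncatedMaximizer_zero (F g : ℝ → ℝ) (θ : ℝ) : truncatedMaximizer F g 0 θ = 0 := by
  simp [truncatedMaximizer]

theorem ConcaveUtility.revenue_zero (hF : RegularTypes F) (hg : ConcaveUtility g) :
    revenue F g 0 = 0 := by
  simp [hg.revenue_eq hF le_rfl, virtualSurplus, truncatedMaximizer_zero, hg.map_zero]

theorem ConcaveUtility.truncatedSurplus_nonneg (hF : RegularTypes F) (hg : ConcaveUtility g)
    {x : ℝ} (hx : 0 ≤ x) : 0 ≤ truncatedSurplus F g x := by
  have h0 : truncatedSurplus F g 0 = 0 := by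
    simp [truncatedSurplus, grossSurplus, utility, truncatedMaximizer_zero, hg.map_zero]
  exact h0.ge.trans (hg.truncatedSurplus_monotoneOn hF self_mem_Ici hx hx)

theorem ConcaveUtility.floorGain_nonneg (hF : RegularTypes F) (hg : ConcaveUtility g)
    {x : ℝ} (hx : 0 ≤ x) : 0 ≤ floorGain F g x := by
  have h0 : floorGain F g 0 = 0 := by simp [floorGain, truncatedMaximizer_zero]
  exact h0.ge.trans (hg.floorGain_monotoneOn hF self_mem_Ici hx hx)

end Integrals

/-! ### Incentive compatibility and the envelope formula -/

section Envelope
variable {F g c A t U : ℝ → ℝ}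

/-- The function `A` is a subgradient of the indirect utility `U` at every type. -/
def IsSubgradient (U A : ℝ → ℝ) : Prop :=
  ∀ θ ∈ Θ, ∀ θ' ∈ Θ, (θ - θ') * A θ' ≤ U θ - U θ'

theorem IsSubgradient.monotoneOn (h : IsSubgradient U A) : MonotoneOn A Θ := by
  intro x hx y hy hxy
  rcases hxy.lt_or_eq with hlt | rfl
  · have h1 := h x hx y hy
    have h2 := h y hy x hx
    by_contra! hcon
    nlinarith [sub_pos.2 hlt]
  · exact le_rfl

theorem IsSubgradient.monotoneOn_indirect (h : IsSubgradient U A) (h0 : ∀ θ ∈ Θ, 0 ≤ A θ) :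
    MonotoneOn U Θ := by
  intro x hx y hy hxy
  have := h y hy x hx
  nlinarith [h0 x hx, sub_nonneg.2 hxy]

theorem IsSubgradient.abs_sub_le (h : IsSubgradient U A) {x y : ℝ} (hx : x ∈ Θ) (hy : y ∈ Θ) :
    |U y - U x - (y - x) * A x| ≤ |A y - A x| * |y - x| := by
  have h1 := h y hy x hx
  have h2 := h x hx y hy
  rw [← abs_mul, abs_of_nonneg (by linarith)]
  refine le_trans ?_ (le_abs_self _)
  linarith

/-- The subgradient inequalities at x and at y bound the error of the difference quotient by |A y -
A x|. -/
theorem IsSubgradient.hasDerivAt (h : IsSubgradient U A) {x : ℝ} (hx : x ∈ Ioo (0 : ℝ) 1)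
    (hA : ContinuousAt A x) : HasDerivAt U (A x) x := by
  rw [hasDerivAt_iff_tendsto]
  have h0 : Tendsto (fun y => |A y - A x|) (𝓝 x) (𝓝 0) := by
    have : ContinuousAt (fun y => |A y - A x|) x := (hA.sub continuousAt_const).abs
    simpa [ContinuousAt] using this
  refine squeeze_zero' (Eventually.of_forall fun y => by positivity) ?_ h0
  filter_upwards [Icc_mem_nhds hx.1 hx.2] with y hy
  have h1 := h.abs_sub_le (Ioo_subset_Icc_self hx) hy
  rw [smul_eq_mul, Real.norm_eq_abs, Real.norm_eq_abs]
  rcases eq_or_ne y x with rfl | hne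
  · simp
  · rw [inv_mul_le_iff₀ (abs_pos.2 (sub_ne_zero.2 hne)), mul_comm |y - x|]
    exact h1

theorem IsSubgradient.continuousOn (h : IsSubgradient U A) : ContinuousOn U Θ := by
  intro x hx
  have h0 : Tendsto (fun y => (|A 0 - A x| + |A 1 - A x| + |A x|) * |y - x|) (𝓝[Θ] x) (𝓝 0) := by
    have : ContinuousWithinAt (fun y => (|A 0 - A x| + |A 1 - A x| + |A x|) * |y - x|) Θ x := by
      fun_prop
    simpa [ContinuousWithinAt] using this
  refine tendsto_iff_dist_tendsto_zero.2 (squeeze_zero' (Eventually.of_forall fun _ => dist_nonneg)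
    (eventually_mem_nhdsWithin.mono fun y hy => ?_) h0)
  have h1 := h.abs_sub_le hx hy
  have h2 : |A y - A x| ≤ |A 0 - A x| + |A 1 - A x| := by
    have ha := h.monotoneOn zero_mem_types hy hy.1
    have hb := h.monotoneOn hy one_mem_types hy.2
    have := neg_abs_le (A 0 - A x)
    have := le_abs_self (A 1 - A x)
    exact abs_le.2 ⟨by linarith [abs_nonneg (A 1 - A x)], by linarith [abs_nonneg (A 0 - A x)]⟩
  have h3 := mul_le_mul_of_nonneg_right h2 (abs_nonneg (y - x))
  have h4 : |U y - U x| ≤ |U y - U x - (y - x) * A x| + |(y - x) * A x| := by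
    simpa using abs_add_le (U y - U x - (y - x) * A x) ((y - x) * A x)
  rw [abs_mul (y - x)] at h4
  rw [Real.dist_eq]
  linarith

/-- The envelope formula, integrated against the type law. -/
theorem IsSubgradient.integral_indirect (hF : RegularTypes F) (h : IsSubgradient U A) :
    ∫ θ, U θ ∂(typeLaw F) = U 0 + ∫ θ, (θ - virtualValue F θ) * A θ ∂(typeLaw F) := by
  have huIcc : uIcc (0 : ℝ) 1 = Θ := uIcc_of_le zero_le_one
  have hFc : ContinuousOn F Θ := hF.differentiable.continuousOn
  have hiA : IntervalIntegrable (fun θ => A θ * (1 - F θ)) volume 0 1 := by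
    have hm : IntervalIntegrable A volume 0 1 :=
      MonotoneOn.intervalIntegrable (huIcc ▸ h.monotoneOn)
    exact hm.mul_continuousOn (huIcc ▸ continuousOn_const.sub hFc)
  have hiU : IntervalIntegrable (fun θ => density F θ * U θ) volume 0 1 := by
    apply ContinuousOn.intervalIntegrable
    rw [huIcc]
    exact hF.continuousOn_density.mul h.continuousOn
  -- Integration by parts for U(1 - F). The monotone A has countably many discontinuities and U' = A
  -- elsewhere; the boundary term at 1 vanishes since F(1) = 1.
  have key := integral_eq_of_hasDerivAt_off_countable_of_le (fun θ => U θ * (1 - F θ))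
    (fun θ => A θ * (1 - F θ) - density F θ * U θ) zero_le_one
    h.monotoneOn.countable_not_continuousWithinAt
    (h.continuousOn.mul (continuousOn_const.sub hFc)) (fun x hx => ?_) (hiA.sub hiU)
  · rw [intervalIntegral.integral_sub hiA hiU, hF.map_one, hF.map_zero] at key
    rw [hF.integral_typeLaw, hF.integral_typeLaw]
    have : ∫ θ in (0 : ℝ)..1, density F θ * ((θ - virtualValue F θ) * A θ) =
        ∫ θ in (0 : ℝ)..1, A θ * (1 - F θ) := by
      refine intervalIntegral.integral_congr fun θ hθ => ?_
      rw [huIcc] at hθ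
      have := hF.virtualValue_mul_density hθ
      linear_combination (-A θ) * this
    rw [this]
    linarith
  · have hc : ContinuousAt A x := by
      have : ContinuousWithinAt A Θ x := by
        by_contra hcon
        exact hx.2 ⟨Ioo_subset_Icc_self hx.1, hcon⟩
      exact this.continuousAt (Icc_mem_nhds hx.1.1 hx.1.2)
    exact ((h.hasDerivAt hx.1 hc).mul ((hasDerivAt_const x 1).sub (hF.hasDerivAt hx.1))).congr_deriv
      (by simp only [Pi.sub_apply]; ring)

theorem IsMechanism.isSubgradient (h : IsMechanism g A t) :
    IsSubgradient (fun θ => utility g (A θ) θ - t θ) A := by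
  intro θ hθ θ' hθ'
  have := h.incentive θ hθ θ' hθ'
  simp only [utility] at this ⊢
  linarith

/-- Expected transfers are the virtual surplus less the utility of the lowest type. -/
theorem IsMechanism.integral_transfer (hF : RegularTypes F) (hg : ConcaveUtility g)
    (h : IsMechanism g A t) :
    ∫ θ, t θ ∂(typeLaw F) = ∫ θ, virtualSurplus F g (A θ) θ ∂(typeLaw F) -
      (utility g (A 0) 0 - t 0) := by
  have hs := h.isSubgradient
  have h0 := h.allocation.2
  have h1 := hs.integral_indirect hF
  have hiu := hg.integrable_utility hF hs.monotoneOn h0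
  have hiU := hF.integrable_of_monotoneOn (hs.monotoneOn_indirect h0)
  have hir := hF.integrable_rent hs.monotoneOn
  have e1 : ∫ θ, t θ ∂(typeLaw F) = ∫ θ, utility g (A θ) θ ∂(typeLaw F) -
      ∫ θ, (utility g (A θ) θ - t θ) ∂(typeLaw F) := by
    rw [← integral_sub hiu hiU]
    exact integral_congr_ae (ae_of_all _ fun θ => by simp)
  have e2 : ∫ θ, virtualSurplus F g (A θ) θ ∂(typeLaw F) = ∫ θ, utility g (A θ) θ ∂(typeLaw F) -
      ∫ θ, (θ - virtualValue F θ) * A θ ∂(typeLaw F) := by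
    rw [← integral_sub hiu hir]
    refine integral_congr_ae (ae_of_all _ fun θ => ?_)
    simp only [utility, virtualSurplus]
    ring
  rw [e1, e2, h1]
  ring

/-- Every nondecreasing allocation is implemented by transfers that leave no rent to the lowest
type. -/
theorem exists_isMechanism (hA : IsAllocation A) (hm : MonotoneOn A Θ) :
    ∃ t, IsMechanism g A t ∧ utility g (A 0) 0 - t 0 = 0 := by
  have hint : ∀ x ∈ Θ, ∀ y ∈ Θ, IntervalIntegrable A volume x y := fun x hx y hy =>
    MonotoneOn.intervalIntegrable (hm.mono (ordConnected_Icc.uIcc_subset hx hy))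
  have hsub : IsSubgradient (fun θ => ∫ s in (0 : ℝ)..θ, A s) A := by
    intro θ hθ θ' hθ'
    simp only
    rw [intervalIntegral.integral_interval_sub_left (hint 0 zero_mem_types θ hθ)
      (hint 0 zero_mem_types θ' hθ')]
    rcases le_total θ' θ with hle | hle
    · have := intervalIntegral.integral_mono_on hle intervalIntegrable_const (hint θ' hθ' θ hθ)
        (fun s hs => hm hθ' ⟨hθ'.1.trans hs.1, hs.2.trans hθ.2⟩ hs.1)
      simpa using this
    · have := intervalIntegral.integral_mono_on hle (hint θ hθ θ' hθ') intervalIntegrable_const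
        (fun s hs => hm ⟨hθ.1.trans hs.1, hs.2.trans hθ'.2⟩ hθ' hs.2)
      rw [intervalIntegral.integral_symm]
      rw [intervalIntegral.integral_const, smul_eq_mul] at this
      linarith
  -- These transfers leave type θ the indirect utility ∫₀^θ A, of which A is a subgradient by
  -- monotonicity.
  refine ⟨fun θ => utility g (A θ) θ - ∫ s in (0 : ℝ)..θ, A s, ⟨hA, ?_, ?_⟩, by simp⟩
  · intro θ hθ θ' hθ'
    have := hsub θ hθ θ' hθ'
    simp only [utility] at this ⊢
    linarith
  · intro θ hθ
    have := intervalIntegral.integral_nonneg (μ := volume) hθ.1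
      (fun s hs => hA.2 s ⟨hs.1, hs.2.trans hθ.2⟩)
    simpa using this

end Envelope

/-! ### The monopoly cap and the monopolist's welfare -/

section Monopoly
variable {F g c A : ℝ → ℝ} {qM : ℝ}

theorem ConcaveUtility.monopolyProfit_strictConcaveOn (hF : RegularTypes F)
    (hg : ConcaveUtility g) (hc : StrictConvexOn ℝ (Ici 0) c) :
    StrictConcaveOn ℝ (Ici 0) fun q => revenue F g q - c q := by
  simp only [sub_eq_add_neg]
  exact (hg.revenue_concaveOn hF).add_strictConcaveOn hc.neg

theorem IsMonopolyCap.unique (hF : RegularTypes F) (hg : ConcaveUtility g)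
    (hc : StrictConvexOn ℝ (Ici 0) c) (h : IsMonopolyCap F g c qM) {q : ℝ} (hq : 0 ≤ q)
    (hle : revenue F g qM - c qM ≤ revenue F g q - c q) : q = qM :=
  (hg.monopolyProfit_strictConcaveOn hF hc).eq_of_isMaxOn
    (fun x hx => (h.2 x hx).trans hle) (fun x hx => h.2 x hx) hq h.1

theorem IsMonopolyCap.monotoneOn (hF : RegularTypes F) (hg : ConcaveUtility g)
    (hc : StrictConvexOn ℝ (Ici 0) c) (h : IsMonopolyCap F g c qM) :
    MonotoneOn (fun q => revenue F g q - c q) (Icc 0 qM) := by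
  intro x hx y hy hxy
  rcases hy.2.lt_or_eq with hlt | rfl
  · have hconc := (hg.monopolyProfit_strictConcaveOn hF hc).concaveOn
    have hseg : y ∈ segment ℝ x qM := by
      rw [segment_eq_Icc hx.2]
      exact ⟨hxy, hy.2⟩
    have := hconc.min_le_of_mem_segment (mem_Ici.2 hx.1) (mem_Ici.2 h.1) hseg
    exact (le_min le_rfl (h.2 x hx.1)).trans this
  · exact h.2 x hx.1

/-- A monopolist's welfare is that of the virtual-surplus maximizer truncated at the monopoly
cap. -/
theorem IsMonopolist.welfare_eq (hF : RegularTypes F) (hg : ConcaveUtility g)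
    (hc : StrictConvexOn ℝ (Ici 0) c) (hq : IsMonopolyCap F g c qM)
    (h : IsMonopolist F g c A) : welfare F g c A = truncatedSurplus F g qM - c qM := by
  obtain ⟨t, hmech, hopt⟩ := h
  have hmono := hmech.isSubgradient.monotoneOn
  have h0 := hmech.allocation.2
  obtain ⟨t', hmech', ht'⟩ := exists_isMechanism (g := g) (hg.isAllocation_truncated hF hq.1)
    (hg.truncatedMaximizer_monotoneOn hF hq.1)
  have hle := hopt _ t' hmech'
  have hA1 := h0 1 one_mem_types
  have hbound := hg.integral_virtualSurplus_le hF hmono h0 hA1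
    (fun θ hθ => hmono hθ one_mem_types hθ.2)
  rw [profit, profit, hmech.integral_transfer hF hg, hmech'.integral_transfer hF hg, ht',
    hg.topQuality_truncated hF hq.1, topQuality_of_monotoneOn hmono, ← hg.revenue_eq hF hq.1]
    at hle
  rw [← hg.revenue_eq hF hA1] at hbound
  have hpart := hmech.participation 0 zero_mem_types
  -- The profit from A is at most V(A 1) - c(A 1), less the lowest type's rent, yet at least V(q^M)
  -- - c(q^M), which is attainable. Uniqueness of the maximizer of V - c fixes the top quality.
  have htop : A 1 = qM := hq.unique hF hg hc hA1 (by linarith)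
  have hAq : ∀ θ ∈ Θ, A θ ≤ qM := fun θ hθ => htop ▸ hmono hθ one_mem_types hθ.2
  have hint := hg.integrable_virtualSurplus hF hmono h0
  have hintB := hg.integrable_virtualSurplus_truncated hF hq.1
  -- The integrand is nonnegative, so A attains the maximal virtual surplus almost everywhere;
  -- strict optimality where φ ≠ 0 then identifies A itself.
  have hzero : ∫ θ, (virtualSurplus F g (truncatedMaximizer F g qM θ) θ -
      virtualSurplus F g (A θ) θ) ∂(typeLaw F) = 0 := by
    rw [integral_sub hintB hint, ← hg.revenue_eq hF hq.1]
    rw [htop] at hle hbound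
    linarith
  have hae := (integral_eq_zero_iff_of_nonneg_ae
    ((ae_typeLaw_mem F).mono fun θ hθ => sub_nonneg.2 (hg.virtualSurplus_le (h0 θ hθ) (hAq θ hθ)))
    (hintB.sub hint)).1 hzero
  have heq : ∀ᵐ θ ∂(typeLaw F), A θ = truncatedMaximizer F g qM θ := by
    filter_upwards [hae, ae_typeLaw_mem F, hF.ae_virtualValue_ne_zero] with θ h1 hθ hne
    by_contra hcon
    have := hg.virtualSurplus_lt hne (h0 θ hθ) (hAq θ hθ) hcon
    exact absurd h1 (sub_pos.2 this).ne'
  rw [welfare, topQuality_of_monotoneOn hmono, htop, truncatedSurplus, grossSurplus, grossSurplus]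
  congr 1
  exact integral_congr_ae (heq.mono fun θ hθ => by simp only [hθ])

end Monopoly

/-! ### Laws of the two highest caps -/

section OrderStatistics
variable {n : ℕ}

theorem highestCap_le_iff (hn : 0 < n) (k : Fin n → ℝ) (s : ℝ) :
    highestCap k ≤ s ↔ ∀ i, k i ≤ s := by
  have : Nonempty (Fin n) := ⟨⟨0, hn⟩⟩
  exact ciSup_le_iff (finite_range k).bddAbove

theorem le_highestCap (k : Fin n → ℝ) (i : Fin n) : k i ≤ highestCap k :=
  le_ciSup (finite_range k).bddAbove i

theorem secondCap_le_iff (hn : 2 ≤ n) (k : Fin n → ℝ) (s : ℝ) :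
    secondCap k ≤ s ↔ ∃ i, ∀ j, j ≠ i → k j ≤ s := by
  have : Nontrivial (Fin n) := Fin.nontrivial_iff_two_le.2 hn
  -- With at least two firms every inner supremum is over a nonempty set; an empty one would take
  -- the default value 0.
  have hne : ∀ i : Fin n, Nonempty {j : Fin n // j ≠ i} := fun i =>
    (exists_ne i).elim fun j hj => ⟨⟨j, hj⟩⟩
  have hsup : ∀ i : Fin n, (⨆ j : {j : Fin n // j ≠ i}, k j) ≤ s ↔ ∀ j, j ≠ i → k j ≤ s := by
    intro i
    have := hne i
    rw [ciSup_le_iff (finite_range _).bddAbove]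
    exact ⟨fun h j hj => h ⟨j, hj⟩, fun h j => h j j.2⟩
  constructor
  · intro h
    obtain ⟨i, hi⟩ := exists_eq_ciInf_of_finite
      (f := fun i : Fin n => ⨆ j : {j : Fin n // j ≠ i}, k j)
    exact ⟨i, (hsup i).1 (hi.trans_le h)⟩
  · rintro ⟨i, hi⟩
    exact (ciInf_le (finite_range _).bddBelow i).trans ((hsup i).2 hi)

theorem secondCap_le_highestCap (hn : 2 ≤ n) (k : Fin n → ℝ) : secondCap k ≤ highestCap k :=
  (secondCap_le_iff hn k _).2 ⟨⟨0, by omega⟩, fun j _ => le_highestCap k j⟩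

theorem le_secondCap (hn : 2 ≤ n) {k : Fin n → ℝ} {s : ℝ} (h : ∀ i, s ≤ k i) :
    s ≤ secondCap k := by
  have : Nontrivial (Fin n) := Fin.nontrivial_iff_two_le.2 hn
  obtain ⟨i, hi⟩ := (secondCap_le_iff hn k _).1 le_rfl
  obtain ⟨j, hj⟩ := exists_ne i
  exact (h j).trans (hi j hj)

theorem measurable_highestCap (hn : 0 < n) : Measurable (highestCap (n := n)) := by
  refine measurable_of_Iic fun s => ?_
  have : highestCap (n := n) ⁻¹' Iic s = ⋂ i, {k | k i ≤ s} := by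
    ext k
    simp [highestCap_le_iff hn]
  rw [this]
  exact MeasurableSet.iInter fun i => measurableSet_le (measurable_pi_apply i) measurable_const

theorem measurable_secondCap (hn : 2 ≤ n) : Measurable (secondCap (n := n)) := by
  refine measurable_of_Iic fun s => ?_
  have : secondCap (n := n) ⁻¹' Iic s = ⋃ i, ⋂ j, ⋂ (_ : j ≠ i), {k | k j ≤ s} := by
    ext k
    simp [secondCap_le_iff hn]
  rw [this]
  exact MeasurableSet.iUnion fun i => MeasurableSet.iInter fun j => MeasurableSet.iInter fun _ =>
    measurableSet_le (measurable_pi_apply j) measurable_const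

variable (ν : Measure ℝ) [IsProbabilityMeasure ν]

/-- The law of the highest of `n` independent caps. -/
noncomputable def highestLaw (n : ℕ) (ν : Measure ℝ) : Measure ℝ :=
  (Measure.pi fun _ : Fin n => ν).map highestCap

/-- The law of the second-highest of `n` independent caps. -/
noncomputable def secondLaw (n : ℕ) (ν : Measure ℝ) : Measure ℝ :=
  (Measure.pi fun _ : Fin n => ν).map secondCap

theorem isProbabilityMeasure_highestLaw (hn : 0 < n) : IsProbabilityMeasure (highestLaw n ν) :=
  Measure.isProbabilityMeasure_map (measurable_highestCap hn).aemeasurable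

theorem isProbabilityMeasure_secondLaw (hn : 2 ≤ n) : IsProbabilityMeasure (secondLaw n ν) :=
  Measure.isProbabilityMeasure_map (measurable_secondCap hn).aemeasurable

theorem highestLaw_real_Iic (hn : 0 < n) (s : ℝ) :
    (highestLaw n ν).real (Iic s) = ν.real (Iic s) ^ n := by
  rw [highestLaw, map_measureReal_apply (measurable_highestCap hn) measurableSet_Iic]
  have : highestCap (n := n) ⁻¹' Iic s = univ.pi fun _ => Iic s := by
    ext k
    simp [highestCap_le_iff hn, Pi.le_def]
  rw [this, measureReal_def, Measure.pi_pi]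
  simp [measureReal_def]

theorem pi_real_others_le (s : ℝ) (i : Fin n) :
    (Measure.pi fun _ : Fin n => ν).real {k | ∀ j, j ≠ i → k j ≤ s} = ν.real (Iic s) ^ (n - 1) := by
  have : {k : Fin n → ℝ | ∀ j, j ≠ i → k j ≤ s} =
      univ.pi fun j => if j = i then univ else Iic s := by
    ext k
    simp only [mem_ofPred_eq, mem_univ_pi]
    refine forall_congr' fun j => ?_
    by_cases h : j = i <;> simp [h]
  rw [this, measureReal_def, Measure.pi_pi, ENNReal.toReal_prod]
  have h2 : ∀ j, (ν (if j = i then univ else Iic s)).toReal =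
      if j = i then 1 else ν.real (Iic s) := by
    intro j
    by_cases h : j = i <;> simp [h, measureReal_def]
  simp_rw [h2]
  rw [Finset.prod_ite]
  simp [Finset.filter_ne', Finset.card_erase_of_mem]

/-- Count the firms i all of whose rivals are at most s: there are n of them if no cap exceeds s,
one if exactly one does, and none otherwise. Taking expectations of this count gives the formula. -/
theorem secondLaw_real_Iic (hn : 2 ≤ n) (s : ℝ) :
    (secondLaw n ν).real (Iic s) =
      n * ν.real (Iic s) ^ (n - 1) - (n - 1) * ν.real (Iic s) ^ n := by
  classical
  set P := Measure.pi fun _ : Fin n => ν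
  have hn0 : 0 < n := by omega
  have hm1 : MeasurableSet {k : Fin n → ℝ | secondCap k ≤ s} :=
    measurableSet_le (measurable_secondCap hn) measurable_const
  have hm2 : MeasurableSet {k : Fin n → ℝ | highestCap k ≤ s} :=
    measurableSet_le (measurable_highestCap hn0) measurable_const
  have hm3 : ∀ i, MeasurableSet {k : Fin n → ℝ | ∀ j, j ≠ i → k j ≤ s} := by
    intro i
    simp only [ofPred_forall]
    exact MeasurableSet.iInter fun j => MeasurableSet.iInter fun _ =>
      measurableSet_le (measurable_pi_apply j) measurable_const
  have hpt : ∀ k : Fin n → ℝ,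
      ∑ i, ({k : Fin n → ℝ | ∀ j, j ≠ i → k j ≤ s}.indicator (fun _ => (1 : ℝ)) k) =
        {k : Fin n → ℝ | secondCap k ≤ s}.indicator (fun _ => (1 : ℝ)) k +
          ((n : ℝ) - 1) * {k : Fin n → ℝ | highestCap k ≤ s}.indicator (fun _ => (1 : ℝ)) k := by
    intro k
    simp only [indicator_apply, mem_ofPred_eq, secondCap_le_iff hn, highestCap_le_iff hn0]
    by_cases hall : ∀ i, k i ≤ s
    · rw [if_pos hall, if_pos ⟨⟨0, hn0⟩, fun j _ => hall j⟩,
        Finset.sum_congr rfl fun i _ => if_pos fun j _ => hall j]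
      simp
    · rw [if_neg hall]
      push Not at hall
      obtain ⟨i₀, hi₀⟩ := hall
      have huniq : ∀ i, (∀ j, j ≠ i → k j ≤ s) → i = i₀ := by
        intro i hi
        by_contra hne
        exact absurd (hi i₀ (Ne.symm hne)) (not_le.2 hi₀)
      rw [Finset.sum_eq_single i₀ (fun i _ hne => if_neg fun h => hne (huniq i h)) (by simp)]
      have : (∃ i, ∀ j, j ≠ i → k j ≤ s) ↔ ∀ j, j ≠ i₀ → k j ≤ s :=
        ⟨fun ⟨i, hi⟩ => huniq i hi ▸ hi, fun h => ⟨i₀, h⟩⟩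
      simp [this]
  have hint : ∀ S : Set (Fin n → ℝ), MeasurableSet S →
      Integrable (S.indicator fun _ => (1 : ℝ)) P := fun S hS =>
    (integrable_const _).indicator hS
  have hI := integral_congr_ae (μ := P) (ae_of_all _ hpt)
  rw [integral_finsetSum _ fun i _ => hint _ (hm3 i),
    integral_add (hint _ hm1) ((hint _ hm2).const_mul _), integral_const_mul] at hI
  simp only [integral_indicator_const (μ := P) (1 : ℝ) (hm3 _),
    integral_indicator_const (μ := P) (1 : ℝ) hm1, integral_indicator_const (μ := P) (1 : ℝ) hm2,
    smul_eq_mul, mul_one] at hI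
  have e1 : P.real {k | secondCap k ≤ s} = (secondLaw n ν).real (Iic s) := by
    rw [secondLaw, map_measureReal_apply (measurable_secondCap hn) measurableSet_Iic]
    rfl
  have e2 : P.real {k | highestCap k ≤ s} = ν.real (Iic s) ^ n := by
    rw [← highestLaw_real_Iic ν hn0, highestLaw,
      map_measureReal_apply (measurable_highestCap hn0) measurableSet_Iic]
    rfl
  rw [e1, e2, Finset.sum_congr rfl fun i _ => pi_real_others_le ν s i] at hI
  simp at hI
  linarith

end OrderStatistics

/-! ### Stochastic dominance and the layer-cake formula -/

section Dominance

/-- A lower set of the line is empty, everything, or a closed or open left ray; an open ray is an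
increasing union of closed ones. -/
theorem measure_lowerSet_le {μ₁ μ₂ : Measure ℝ} [IsProbabilityMeasure μ₁]
    [IsProbabilityMeasure μ₂] (h : ∀ s, μ₁ (Iic s) ≤ μ₂ (Iic s)) {L : Set ℝ} (hL : IsLowerSet L) :
    μ₁ L ≤ μ₂ L := by
  rcases L.eq_empty_or_nonempty with rfl | hne
  · simp
  by_cases hb : BddAbove L
  · by_cases ha : sSup L ∈ L
    · have : L = Iic (sSup L) := Subset.antisymm (fun x hx => le_csSup hb hx) fun x hx => hL hx ha
      rw [this]
      exact h _
    · have : L = Iio (sSup L) := by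
        refine Subset.antisymm (fun x hx => lt_of_le_of_ne (le_csSup hb hx) ?_) fun x hx => ?_
        · rintro rfl
          exact ha hx
        · obtain ⟨y, hy, hxy⟩ := exists_lt_of_lt_csSup hne hx
          exact hL hxy.le hy
      obtain ⟨u, humono, hlt, hu⟩ := exists_seq_strictMono_tendsto (sSup L)
      have hU := iUnion_Iic_eq_Iio_of_lt_of_tendsto hlt hu
      have hmono : Monotone fun n => Iic (u n) := fun i j hij =>
        Iic_subset_Iic.2 (humono.monotone hij)
      rw [this, ← hU]
      exact le_of_tendsto_of_tendsto' (tendsto_measure_iUnion_atTop hmono)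
        (tendsto_measure_iUnion_atTop hmono) fun n => h (u n)
  · have : L = univ := by
      refine eq_univ_of_forall fun x => ?_
      obtain ⟨y, hy, hxy⟩ := not_bddAbove_iff.1 hb x
      exact hL hxy.le hy
    simp [this]

theorem Monotone.integrable_of_abs_le {μ : Measure ℝ} [IsProbabilityMeasure μ] {ψ : ℝ → ℝ}
    (hψ : Monotone ψ) {C : ℝ} (hC : ∀ x, |ψ x| ≤ C) : Integrable ψ μ :=
  Integrable.of_bound hψ.measurable.aestronglyMeasurable C (ae_of_all _ hC)

/-- First-order stochastic dominance. -/
theorem integral_mono_of_cdf_le {μ₁ μ₂ : Measure ℝ} [IsProbabilityMeasure μ₁]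
    [IsProbabilityMeasure μ₂] (h : ∀ s, μ₁.real (Iic s) ≤ μ₂.real (Iic s)) {ψ : ℝ → ℝ}
    (hψ : Monotone ψ) {C : ℝ} (hC : ∀ x, |ψ x| ≤ C) : ∫ x, ψ x ∂μ₂ ≤ ∫ x, ψ x ∂μ₁ := by
  have h' : ∀ s, μ₁ (Iic s) ≤ μ₂ (Iic s) := fun s =>
    (ENNReal.toReal_le_toReal (measure_ne_top _ _) (measure_ne_top _ _)).1 (h s)
  -- Superlevel sets of a monotone function are complements of lower sets. Adding C makes the
  -- function nonnegative, as the layer-cake formula requires.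
  have hupper : ∀ t, μ₂ {x | t < ψ x + C} ≤ μ₁ {x | t < ψ x + C} := by
    intro t
    have hms : MeasurableSet {x | t < ψ x + C} :=
      measurableSet_lt measurable_const (hψ.measurable.add_const C)
    have hlow : IsLowerSet {x | t < ψ x + C}ᶜ := by
      intro x y hyx hx hy
      have h1 : t < ψ y + C := hy
      exact hx (h1.trans_le (add_le_add_left (hψ hyx) C))
    have := measure_lowerSet_le h' hlow
    rw [prob_compl_eq_one_sub hms, prob_compl_eq_one_sub hms] at this
    exact (ENNReal.sub_le_sub_iff_left prob_le_one ENNReal.one_ne_top).1 this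
  have hnn : ∀ x, 0 ≤ ψ x + C := fun x => by linarith [neg_abs_le (ψ x), hC x]
  have hint : ∀ μ : Measure ℝ, IsProbabilityMeasure μ →
      ∫ x, ψ x ∂μ = ∫ x, (ψ x + C) ∂μ - C := by
    intro μ hμ
    rw [integral_add (Monotone.integrable_of_abs_le hψ hC) (integrable_const C)]
    simp
  have hfin : ∫⁻ x, ENNReal.ofReal (ψ x + C) ∂μ₁ ≠ ⊤ :=
    ((Monotone.integrable_of_abs_le hψ hC).add
      (integrable_const C)).lintegral_lt_top.ne
  rw [hint μ₁ inferInstance, hint μ₂ inferInstance]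
  refine sub_le_sub_right ?_ C
  rw [integral_eq_lintegral_of_nonneg_ae (ae_of_all _ hnn)
      (hψ.measurable.add_const C).aestronglyMeasurable,
    integral_eq_lintegral_of_nonneg_ae (ae_of_all _ hnn)
      (hψ.measurable.add_const C).aestronglyMeasurable]
  refine ENNReal.toReal_mono hfin ?_
  rw [lintegral_eq_lintegral_meas_lt μ₁ (ae_of_all _ hnn) (hψ.measurable.add_const C).aemeasurable,
    lintegral_eq_lintegral_meas_lt μ₂ (ae_of_all _ hnn) (hψ.measurable.add_const C).aemeasurable]
  exact lintegral_mono fun t => hupper t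

/-- The layer-cake formula for an absolutely continuous function of a bounded random variable. -/
theorem integral_eq_add_integral_tail {μ : Measure ℝ} [IsProbabilityMeasure μ] {M : ℝ}
    (hM : 0 ≤ M) (hμ : ∀ᵐ x ∂μ, x ∈ Icc 0 M) {ψ ψ' : ℝ → ℝ} (hi : Integrable ψ μ)
    (hψ' : IntervalIntegrable ψ' volume 0 M)
    (hftc : ∀ x ∈ Icc 0 M, ∫ s in (0 : ℝ)..x, ψ' s = ψ x - ψ 0) :
    ∫ x, ψ x ∂μ = ψ 0 + ∫ s in (0 : ℝ)..M, ψ' s * (1 - μ.real (Iic s)) := by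
  have hint : Integrable ψ' (volume.restrict (Ioc 0 M)) :=
    (intervalIntegrable_iff_integrableOn_Ioc_of_le hM).1 hψ'
  -- Fubini for ψ'(s) on the region s < x: integrating in s first gives ψ(x) - ψ(0), in x first the
  -- tail probability.
  have hprod : Integrable (Function.uncurry fun x s => (Iio x).indicator ψ' s)
      (μ.prod (volume.restrict (Ioc 0 M))) := by
    have h1 : Integrable (fun p : ℝ × ℝ => ψ' p.2) (μ.prod (volume.restrict (Ioc 0 M))) :=
      hint.comp_snd μ
    have h2 := h1.indicator (measurableSet_lt measurable_snd measurable_fst)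
    refine h2.congr (ae_of_all _ fun p => ?_)
    simp only [indicator_apply, mem_ofPred_eq, Function.uncurry, mem_Iio]
  have hswap := integral_integral_swap hprod
  have hleft : ∫ x, (∫ s in Ioc 0 M, (Iio x).indicator ψ' s) ∂μ = ∫ x, (ψ x - ψ 0) ∂μ := by
    refine integral_congr_ae (hμ.mono fun x hx => ?_)
    simp only
    have e : ∫ s in Ioc 0 x, ψ' s = ∫ s in Ioo 0 x, ψ' s := integral_Ioc_eq_integral_Ioo
    rw [← hftc x hx, intervalIntegral.integral_of_le hx.1, e,
      setIntegral_indicator measurableSet_Iio]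
    congr 2
    ext s
    exact ⟨fun h => ⟨h.1.1, mem_Iio.1 h.2⟩,
      fun h => ⟨⟨h.1, (le_of_lt h.2).trans hx.2⟩, mem_Iio.2 h.2⟩⟩
  have hright : ∫ s in Ioc 0 M, (∫ x, (Iio x).indicator ψ' s ∂μ) =
      ∫ s in (0 : ℝ)..M, ψ' s * (1 - μ.real (Iic s)) := by
    rw [intervalIntegral.integral_of_le hM]
    refine integral_congr_ae (ae_of_all _ fun s => ?_)
    have : ∀ x, (Iio x).indicator ψ' s = (Ioi s).indicator (fun _ => ψ' s) x := by
      intro x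
      simp only [indicator_apply, mem_Iio, mem_Ioi]
    simp only [this]
    rw [integral_indicator_const _ measurableSet_Ioi, ← compl_Iic,
      measureReal_compl measurableSet_Iic, probReal_univ, smul_eq_mul, mul_comm]
  rw [hleft, hright, integral_sub hi (integrable_const _)] at hswap
  simp at hswap
  linarith

end Dominance

/-! ### Calculus of concave functions on the half-line -/

section Calculus
variable {f : ℝ → ℝ}

theorem intervalIntegrable_deriv_of_monotoneOn (hm : MonotoneOn f (Ici 0)) {x y : ℝ}
    (hx : 0 ≤ x) (hy : 0 ≤ y) : IntervalIntegrable (deriv f) volume x y :=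
  (hm.mono fun _ hz => (le_min hx hy).trans hz.1).intervalIntegrable_deriv

/-- Slopes of a concave function to the right of ε are at most the chord slope over [0, ε]. Staying
away from 0 is necessary, since the slope there may be infinite. -/
theorem lipschitzOnWith_of_concaveOn (hf : ConcaveOn ℝ (Ici 0) f) (hm : MonotoneOn f (Ici 0))
    {ε x : ℝ} (hε : 0 < ε) :
    LipschitzOnWith (Real.toNNReal ((f ε - f 0) / ε)) f (Icc ε x) := by
  have hK : 0 ≤ (f ε - f 0) / ε :=
    div_nonneg (sub_nonneg.2 (hm self_mem_Ici (mem_Ici.2 hε.le) hε.le)) hε.le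
  have key : ∀ y ∈ Icc ε x, ∀ z ∈ Icc ε x, y < z → f z - f y ≤ (f ε - f 0) / ε * (z - y) := by
    intro y hy z hz hyz
    have hy0 : 0 < y := hε.trans_le hy.1
    have h1 : (f y - f 0) / (y - 0) ≤ (f ε - f 0) / ε := by
      rcases hy.1.lt_or_eq with h | rfl
      · have hh := hf.2 (self_mem_Ici (a := (0 : ℝ))) (mem_Ici.2 hy0.le)
          (sub_nonneg.2 ((div_le_one hy0).2 hy.1) : 0 ≤ 1 - ε / y)
          (by positivity : 0 ≤ ε / y) (by ring)
        have hpt : (1 - ε / y) • (0 : ℝ) + (ε / y) • y = ε := by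
          simp only [smul_eq_mul]
          field_simp
          ring
        rw [hpt] at hh
        simp only [smul_eq_mul] at hh
        rw [sub_zero, le_div_iff₀ hε]
        have : (f y - f 0) / y * ε = ε / y * (f y - f 0) := by ring
        rw [this]
        linarith
      · simp
    have h2 := hf.slope_anti_adjacent (self_mem_Ici (a := (0 : ℝ)))
      (mem_Ici.2 (hy0.trans hyz).le) hy0 hyz
    exact (div_le_iff₀ (sub_pos.2 hyz)).1 (h2.trans h1)
  refine LipschitzOnWith.of_dist_le_mul fun y hy z hz => ?_
  rw [Real.coe_toNNReal _ hK, Real.dist_eq, Real.dist_eq]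
  rcases lt_trichotomy y z with h | rfl | h
  · rw [abs_sub_comm, abs_sub_comm y, abs_of_pos (sub_pos.2 h), abs_of_nonneg
      (sub_nonneg.2 (hm (mem_Ici.2 (hε.le.trans hy.1)) (mem_Ici.2 (hε.le.trans hz.1)) h.le))]
    exact key y hy z hz h
  · simp
  · rw [abs_of_pos (sub_pos.2 h), abs_of_nonneg
      (sub_nonneg.2 (hm (mem_Ici.2 (hε.le.trans hz.1)) (mem_Ici.2 (hε.le.trans hy.1)) h.le))]
    exact key z hz y hy h

/-- The fundamental theorem of calculus for nondecreasing concave functions on the half-line. -/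
theorem integral_deriv_of_concaveOn (hf : ConcaveOn ℝ (Ici 0) f) (hm : MonotoneOn f (Ici 0))
    (hc : ContinuousOn f (Ici 0)) {x : ℝ} (hx : 0 ≤ x) :
    ∫ s in (0 : ℝ)..x, deriv f s = f x - f 0 := by
  rcases hx.eq_or_lt with rfl | hx0
  · simp
  have hint := intervalIntegrable_deriv_of_monotoneOn hm le_rfl hx
  have hprim : ContinuousOn (fun ε => ∫ s in (0 : ℝ)..ε, deriv f s) (Icc 0 x) := by
    have := intervalIntegral.continuousOn_primitive_interval (a := 0) (b := x) (f := deriv f)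
      (μ := volume) (by
        rw [uIcc_of_le hx]
        exact (intervalIntegrable_iff_integrableOn_Icc_of_le hx).1 hint)
    rwa [uIcc_of_le hx] at this
  -- On [ε, x] the function is Lipschitz, hence absolutely continuous; then ε → 0 by continuity of f
  -- and of the primitive of its derivative.
  have heq : ∀ ε ∈ Ioc 0 x, ∫ s in (0 : ℝ)..x, deriv f s =
      f x - f ε + ∫ s in (0 : ℝ)..ε, deriv f s := by
    intro ε hε
    have hac : AbsolutelyContinuousOnInterval f ε x :=
      LipschitzOnWith.absolutelyContinuousOnInterval
        (by rw [uIcc_of_le hε.2]; exact lipschitzOnWith_of_concaveOn hf hm hε.1)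
    rw [← hac.integral_deriv_eq_sub, add_comm, intervalIntegral.integral_add_adjacent_intervals
      (intervalIntegrable_deriv_of_monotoneOn hm le_rfl hε.1.le)
      (intervalIntegrable_deriv_of_monotoneOn hm hε.1.le hx)]
  have hne : (𝓝[Ioc 0 x] (0 : ℝ)).NeBot := by
    rw [← mem_closure_iff_nhdsWithin_neBot, closure_Ioc hx0.ne]
    exact left_mem_Icc.2 hx
  have h1 : Tendsto (fun ε => f x - f ε + ∫ s in (0 : ℝ)..ε, deriv f s) (𝓝[Ioc 0 x] 0)
      (𝓝 (f x - f 0 + ∫ s in (0 : ℝ)..0, deriv f s)) :=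
    (tendsto_const_nhds.sub ((hc 0 self_mem_Ici).mono_left
      (nhdsWithin_mono _ fun _ hz => hz.1.le))).add
      ((hprim 0 (left_mem_Icc.2 hx)).mono_left (nhdsWithin_mono _ Ioc_subset_Icc_self))
  have h2 := tendsto_nhds_unique (h1.congr' (eventually_mem_nhdsWithin.mono fun ε hε =>
    (heq ε hε).symm)) tendsto_const_nhds
  simpa using h2.symm

theorem ae_differentiableAt_of_monotoneOn (hm : MonotoneOn f (Ici 0)) :
    ∀ᵐ x, 0 < x → DifferentiableAt ℝ f x := by
  filter_upwards [hm.ae_differentiableWithinAt_of_mem] with x hx hpos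
  exact (hx hpos.le).differentiableAt (Ici_mem_nhds hpos)

theorem deriv_pos_of_concaveOn (hf : ConcaveOn ℝ (Ici 0) f) (hm : StrictMonoOn f (Ici 0)) {x : ℝ}
    (hx : 0 < x) (hd : DifferentiableAt ℝ f x) : 0 < deriv f x := by
  have h1 : x ∈ Ici (0 : ℝ) := hx.le
  have h2 : x + 1 ∈ Ici (0 : ℝ) := by
    rw [mem_Ici]
    linarith
  refine lt_of_lt_of_le ?_ (hf.slope_le_deriv h1 h2 (lt_add_one x) hd)
  rw [slope_def_field]
  exact div_pos (sub_pos.2 (hm h1 h2 (lt_add_one x))) (by simp)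

end Calculus

/-! ### Reduction from monotonicity on [0, M] to monotonicity on the line -/

section Supported
variable {M : ℝ}

/-- The retraction of the line onto `[0, M]`. -/
noncomputable def clamp (M x : ℝ) : ℝ := max 0 (min x M)

theorem clamp_mem (hM : 0 ≤ M) (x : ℝ) : clamp M x ∈ Icc 0 M :=
  ⟨le_max_left _ _, max_le hM (min_le_right _ _)⟩

theorem clamp_of_mem {x : ℝ} (hx : x ∈ Icc 0 M) : clamp M x = x := by
  rw [clamp, min_eq_left hx.2, max_eq_right hx.1]

theorem monotone_comp_clamp (hM : 0 ≤ M) {ψ : ℝ → ℝ} (hψ : MonotoneOn ψ (Icc 0 M)) :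
    Monotone fun x => ψ (clamp M x) := fun x y hxy =>
  hψ (clamp_mem hM x) (clamp_mem hM y) (max_le_max_left 0 (min_le_min_right M hxy))

theorem abs_comp_clamp_le (hM : 0 ≤ M) {ψ : ℝ → ℝ} (hψ : MonotoneOn ψ (Icc 0 M)) (x : ℝ) :
    |ψ (clamp M x)| ≤ |ψ 0| + |ψ M| := by
  have h := clamp_mem hM x
  have h0 := hψ (left_mem_Icc.2 hM) h h.1
  have h1 := hψ h (right_mem_Icc.2 hM) h.2
  have := neg_abs_le (ψ 0)
  have := le_abs_self (ψ M)
  exact abs_le.2 ⟨by linarith [abs_nonneg (ψ M)], by linarith [abs_nonneg (ψ 0)]⟩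

theorem integrable_of_monotoneOn_Icc {μ : Measure ℝ} [IsProbabilityMeasure μ] (hM : 0 ≤ M)
    (hμ : ∀ᵐ x ∂μ, x ∈ Icc 0 M) {ψ : ℝ → ℝ} (hψ : MonotoneOn ψ (Icc 0 M)) : Integrable ψ μ :=
  (Monotone.integrable_of_abs_le (monotone_comp_clamp hM hψ) (abs_comp_clamp_le hM hψ)).congr
    (hμ.mono fun x hx => by simp only [clamp_of_mem hx])

theorem integral_le_of_cdf_le_of_monotoneOn {μ₁ μ₂ : Measure ℝ} [IsProbabilityMeasure μ₁]
    [IsProbabilityMeasure μ₂] (hM : 0 ≤ M) (h₁ : ∀ᵐ x ∂μ₁, x ∈ Icc 0 M)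
    (h₂ : ∀ᵐ x ∂μ₂, x ∈ Icc 0 M) (h : ∀ s, μ₁.real (Iic s) ≤ μ₂.real (Iic s)) {ψ : ℝ → ℝ}
    (hψ : MonotoneOn ψ (Icc 0 M)) : ∫ x, ψ x ∂μ₂ ≤ ∫ x, ψ x ∂μ₁ := by
  have e : ∀ μ : Measure ℝ, (∀ᵐ x ∂μ, x ∈ Icc 0 M) → ∫ x, ψ x ∂μ = ∫ x, ψ (clamp M x) ∂μ :=
    fun μ hμ => integral_congr_ae (hμ.mono fun x hx => by simp only [clamp_of_mem hx])
  rw [e μ₁ h₁, e μ₂ h₂]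
  exact integral_mono_of_cdf_le h (monotone_comp_clamp hM hψ) (abs_comp_clamp_le hM hψ)

end Supported

/-! ### Expected welfare through the marginal laws of the order statistics -/

section Profiles
variable {n : ℕ} {M : ℝ} {ν : Measure ℝ}

theorem integral_comp_highestCap (hn : 0 < n) {ψ : ℝ → ℝ} (hψ : Integrable ψ (highestLaw n ν)) :
    ∫ k, ψ (highestCap k) ∂(Measure.pi fun _ : Fin n => ν) = ∫ x, ψ x ∂(highestLaw n ν) :=
  (integral_map (measurable_highestCap hn).aemeasurable hψ.aestronglyMeasurable).symm

theorem integral_comp_secondCap (hn : 2 ≤ n) {ψ : ℝ → ℝ} (hψ : Integrable ψ (secondLaw n ν)) :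
    ∫ k, ψ (secondCap k) ∂(Measure.pi fun _ : Fin n => ν) = ∫ x, ψ x ∂(secondLaw n ν) :=
  (integral_map (measurable_secondCap hn).aemeasurable hψ.aestronglyMeasurable).symm

theorem integrable_comp_highestCap (hn : 0 < n) {ψ : ℝ → ℝ}
    (hψ : Integrable ψ (highestLaw n ν)) :
    Integrable (fun k => ψ (highestCap k)) (Measure.pi fun _ : Fin n => ν) :=
  hψ.comp_measurable (measurable_highestCap hn)

theorem integrable_comp_secondCap (hn : 2 ≤ n) {ψ : ℝ → ℝ} (hψ : Integrable ψ (secondLaw n ν)) :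
    Integrable (fun k => ψ (secondCap k)) (Measure.pi fun _ : Fin n => ν) :=
  hψ.comp_measurable (measurable_secondCap hn)

variable [IsProbabilityMeasure ν]

theorem ae_pi_mem (hν : ∀ᵐ x ∂ν, x ∈ Icc 0 M) :
    ∀ᵐ k ∂(Measure.pi fun _ : Fin n => ν), ∀ i, k i ∈ Icc 0 M :=
  ae_all_iff.2 fun i =>
    (measurePreserving_eval (fun _ : Fin n => ν) i).quasiMeasurePreserving.ae hν

theorem highestCap_mem (hn : 0 < n) {k : Fin n → ℝ} (hk : ∀ i, k i ∈ Icc 0 M) :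
    highestCap k ∈ Icc 0 M :=
  ⟨(hk ⟨0, hn⟩).1.trans (le_highestCap k _), (highestCap_le_iff hn k M).2 fun i => (hk i).2⟩

theorem secondCap_mem (hn : 2 ≤ n) {k : Fin n → ℝ} (hk : ∀ i, k i ∈ Icc 0 M) :
    secondCap k ∈ Icc 0 M :=
  ⟨le_secondCap hn fun i => (hk i).1,
    (secondCap_le_highestCap hn k).trans (highestCap_mem (by omega) hk).2⟩

theorem ae_highestLaw_mem (hn : 0 < n) (hν : ∀ᵐ x ∂ν, x ∈ Icc 0 M) :
    ∀ᵐ x ∂(highestLaw n ν), x ∈ Icc 0 M :=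
  (ae_map_iff (measurable_highestCap hn).aemeasurable measurableSet_Icc).2
    ((ae_pi_mem hν).mono fun _ hk => highestCap_mem hn hk)

theorem ae_secondLaw_mem (hn : 2 ≤ n) (hν : ∀ᵐ x ∂ν, x ∈ Icc 0 M) :
    ∀ᵐ x ∂(secondLaw n ν), x ∈ Icc 0 M :=
  (ae_map_iff (measurable_secondCap hn).aemeasurable measurableSet_Icc).2
    ((ae_pi_mem hν).mono fun _ hk => secondCap_mem hn hk)

theorem integrable_comp_eval {ψ : ℝ → ℝ} (hψ : Integrable ψ ν) (i : Fin n) :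
    Integrable (fun k => ψ (k i)) (Measure.pi fun _ : Fin n => ν) :=
  (measurePreserving_eval (fun _ : Fin n => ν) i).integrable_comp_of_integrable hψ

theorem integral_sum_comp {ψ : ℝ → ℝ} (hψ : Integrable ψ ν) :
    ∫ k, ∑ i, ψ (k i) ∂(Measure.pi fun _ : Fin n => ν) = n * ∫ x, ψ x ∂ν := by
  rw [integral_finsetSum _ fun i _ => integrable_comp_eval hψ i]
  have : ∀ i : Fin n, ∫ k, ψ (k i) ∂(Measure.pi fun _ : Fin n => ν) = ∫ x, ψ x ∂ν := fun i =>
    integral_comp_eval (μ := fun _ : Fin n => ν) hψ.aestronglyMeasurable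
  simp [this]

variable {F g c : ℝ → ℝ}

theorem ConcaveUtility.expectedWelfare_eq (hF : RegularTypes F) (hg : ConcaveUtility g)
    (hc : MonotoneOn c (Ici 0)) (hn : 2 ≤ n) (hM : 0 ≤ M) (hν : ∀ᵐ x ∂ν, x ∈ Icc 0 M) :
    expectedWelfare F g c n ν =
      ∫ x, (truncatedSurplus F g x - c x) ∂(highestLaw n ν) +
        ∫ y, floorGain F g y ∂(secondLaw n ν) := by
  have hn0 : 0 < n := by omega
  have := isProbabilityMeasure_highestLaw ν hn0
  have := isProbabilityMeasure_secondLaw ν hn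
  have hsub : Icc 0 M ⊆ Ici 0 := Icc_subset_Ici_self
  have h1 : Integrable (fun x => truncatedSurplus F g x - c x) (highestLaw n ν) :=
    (integrable_of_monotoneOn_Icc hM (ae_highestLaw_mem hn0 hν)
      ((hg.truncatedSurplus_monotoneOn hF).mono hsub)).sub
      (integrable_of_monotoneOn_Icc hM (ae_highestLaw_mem hn0 hν) (hc.mono hsub))
  have h2 : Integrable (floorGain F g) (secondLaw n ν) :=
    integrable_of_monotoneOn_Icc hM (ae_secondLaw_mem hn hν)
      ((hg.floorGain_monotoneOn hF).mono hsub)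
  rw [← integral_comp_highestCap hn0 h1, ← integral_comp_secondCap hn h2,
    ← integral_add (integrable_comp_highestCap hn0 h1) (integrable_comp_secondCap hn h2)]
  refine integral_congr_ae ((ae_pi_mem hν).mono fun k hk => ?_)
  have hy := (secondCap_mem hn hk).1
  have hyx := secondCap_le_highestCap hn k
  simp only [welfare, hg.grossSurplus_competitive hF hy hyx, hg.topQuality_competitive hF hy hyx]
  ring

theorem ConcaveUtility.expectedNetSurplus_eq (hF : RegularTypes F) (hg : ConcaveUtility g)
    (hc : MonotoneOn c (Ici 0)) (hn : 2 ≤ n) (hM : 0 ≤ M) (hν : ∀ᵐ x ∂ν, x ∈ Icc 0 M) :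
    expectedNetSurplus F g c n ν =
      ∫ x, truncatedSurplus F g x ∂(highestLaw n ν) + ∫ y, floorGain F g y ∂(secondLaw n ν) -
        n * ∫ x, c x ∂ν := by
  have hn0 : 0 < n := by omega
  have := isProbabilityMeasure_highestLaw ν hn0
  have := isProbabilityMeasure_secondLaw ν hn
  have hsub : Icc 0 M ⊆ Ici 0 := Icc_subset_Ici_self
  have h1 : Integrable (truncatedSurplus F g) (highestLaw n ν) :=
    integrable_of_monotoneOn_Icc hM (ae_highestLaw_mem hn0 hν)
      ((hg.truncatedSurplus_monotoneOn hF).mono hsub)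
  have h2 : Integrable (floorGain F g) (secondLaw n ν) :=
    integrable_of_monotoneOn_Icc hM (ae_secondLaw_mem hn hν)
      ((hg.floorGain_monotoneOn hF).mono hsub)
  have h3 : Integrable c ν := integrable_of_monotoneOn_Icc hM hν (hc.mono hsub)
  have h4 : Integrable (fun k : Fin n → ℝ => truncatedSurplus F g (highestCap k) +
      floorGain F g (secondCap k)) (Measure.pi fun _ : Fin n => ν) :=
    (integrable_comp_highestCap hn0 h1).add (integrable_comp_secondCap hn h2)
  rw [← integral_comp_highestCap hn0 h1, ← integral_comp_secondCap hn h2, ← integral_sum_comp h3,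
    ← integral_add (integrable_comp_highestCap hn0 h1) (integrable_comp_secondCap hn h2),
    ← integral_sub h4
      (integrable_finsetSum _ fun i _ => integrable_comp_eval h3 i)]
  refine integral_congr_ae ((ae_pi_mem hν).mono fun k hk => ?_)
  have hy := (secondCap_mem hn hk).1
  have hyx := secondCap_le_highestCap hn k
  simp only [hg.grossSurplus_competitive hF hy hyx]

/-- Charging all firms for their investments lowers expected welfare. -/
theorem ConcaveUtility.expectedNetSurplus_le (hF : RegularTypes F) (hg : ConcaveUtility g)
    (hc : MonotoneOn c (Ici 0)) (hc0 : ∀ q, 0 ≤ q → 0 ≤ c q) (hn : 2 ≤ n) (hM : 0 ≤ M)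
    (hν : ∀ᵐ x ∂ν, x ∈ Icc 0 M) :
    expectedNetSurplus F g c n ν ≤ expectedWelfare F g c n ν := by
  have hn0 : 0 < n := by omega
  have := isProbabilityMeasure_highestLaw ν hn0
  have hsub : Icc 0 M ⊆ Ici 0 := Icc_subset_Ici_self
  have h1 : Integrable (truncatedSurplus F g) (highestLaw n ν) :=
    integrable_of_monotoneOn_Icc hM (ae_highestLaw_mem hn0 hν)
      ((hg.truncatedSurplus_monotoneOn hF).mono hsub)
  have h2 : Integrable c (highestLaw n ν) :=
    integrable_of_monotoneOn_Icc hM (ae_highestLaw_mem hn0 hν) (hc.mono hsub)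
  have h3 : Integrable c ν := integrable_of_monotoneOn_Icc hM hν (hc.mono hsub)
  rw [hg.expectedNetSurplus_eq hF hc hn hM hν, hg.expectedWelfare_eq hF hc hn hM hν,
    integral_sub h1 h2, ← integral_comp_highestCap hn0 h2, ← integral_sum_comp h3]
  have : ∫ k, c (highestCap k) ∂(Measure.pi fun _ : Fin n => ν) ≤
      ∫ k, ∑ i, c (k i) ∂(Measure.pi fun _ : Fin n => ν) := by
    refine integral_mono_ae (integrable_comp_highestCap hn0 h2)
      (integrable_finsetSum _ fun i _ => integrable_comp_eval h3 i)
      ((ae_pi_mem hν).mono fun k hk => ?_)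
    have : Nonempty (Fin n) := ⟨⟨0, hn0⟩⟩
    obtain ⟨i, hi⟩ := exists_eq_ciSup_of_finite (f := k)
    have hi' : highestCap k = k i := hi.symm
    simp only [hi']
    exact Finset.single_le_sum (f := fun i => c (k i)) (fun j _ => hc0 _ (hk j).1)
      (Finset.mem_univ i)
  linarith

end Profiles

/-! ### Equilibrium cap laws: support, comparison in n, zero profits -/

section Equilibrium
variable {F g c : ℝ → ℝ} {n : ℕ} {ν : Measure ℝ} {qM : ℝ}

/-- The monopoly cap inside a cap law is only asserted to exist; uniqueness identifies it with any
given one. -/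
theorem IsCapLaw.real_Iic_eq (hF : RegularTypes F) (hg : ConcaveUtility g)
    (hc : StrictConvexOn ℝ (Ici 0) c) (h : IsCapLaw F g c n ν) (hq : IsMonopolyCap F g c qM)
    (s : ℝ) : ν.real (Iic s) = capCdf F g c qM n s := by
  obtain ⟨-, q, hq', hcdf⟩ := h
  rw [← hq.unique hF hg hc hq'.1 (hq'.2 qM hq.1)]
  exact hcdf s

theorem IsCapLaw.ae_mem (hF : RegularTypes F) (hg : ConcaveUtility g)
    (hc : StrictConvexOn ℝ (Ici 0) c) (h : IsCapLaw F g c n ν) (hq : IsMonopolyCap F g c qM) :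
    ∀ᵐ x ∂ν, x ∈ Icc 0 qM := by
  have := h.1
  have h1 : ν (Iic 0) = 0 := by
    have := h.real_Iic_eq hF hg hc hq 0
    rw [capCdf, if_pos le_rfl] at this
    exact (measureReal_eq_zero_iff).1 this
  have h2 : ν (Ioi qM) = 0 := by
    -- The distribution function is known to be 1 only strictly above q^M. At q^M its formula
    -- involves V', which need not exist there, so the ray is exhausted from the right.
    have hU : Ioi qM = ⋃ m : ℕ, Ioi (qM + 1 / ((m : ℝ) + 1)) := by
      ext x
      simp only [mem_Ioi, mem_iUnion]
      constructor
      · intro hx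
        obtain ⟨m, hm⟩ := exists_nat_one_div_lt (sub_pos.2 hx)
        exact ⟨m, by linarith⟩
      · rintro ⟨m, hm⟩
        have : (0 : ℝ) < 1 / ((m : ℝ) + 1) := by positivity
        linarith
    rw [hU]
    refine measure_iUnion_null fun m => ?_
    have hpos : (0 : ℝ) < 1 / ((m : ℝ) + 1) := by positivity
    have := h.real_Iic_eq hF hg hc hq (qM + 1 / ((m : ℝ) + 1))
    rw [capCdf, if_neg (by linarith [hq.1]), if_neg (by linarith)] at this
    rw [← compl_Iic, prob_compl_eq_zero_iff measurableSet_Iic]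
    rw [measureReal_def, ENNReal.toReal_eq_one_iff] at this
    exact this
  rw [ae_iff]
  refine measure_mono_null (t := Iic 0 ∪ Ioi qM) (fun x hx => ?_) (measure_union_null h1 h2)
  by_contra hcon
  simp only [mem_union, mem_Iic, mem_Ioi, not_or, not_le, not_lt] at hcon
  exact hx ⟨hcon.1.le, hcon.2⟩

theorem deriv_nonneg_of_monotoneOn_Ici {f : ℝ → ℝ} (hf : MonotoneOn f (Ici 0)) {x : ℝ}
    (hx : 0 < x) : 0 ≤ deriv f x := by
  rw [← derivWithin_of_mem_nhds (Ici_mem_nhds hx)]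
  exact hf.derivWithin_nonneg

/-- The highest opponent's cap is distributed according to `c' / V'`. -/
theorem capCdf_pow (hF : RegularTypes F) (hg : ConcaveUtility g) (hc : MonotoneOn c (Ici 0))
    (hn : 2 ≤ n) {s : ℝ} (hs : s ∈ Ioc 0 qM) :
    capCdf F g c qM n s ^ (n - 1) = deriv c s / deriv (revenue F g) s := by
  have hr : 0 ≤ deriv c s / deriv (revenue F g) s :=
    div_nonneg (deriv_nonneg_of_monotoneOn_Ici hc hs.1)
      (deriv_nonneg_of_monotoneOn_Ici (hg.revenue_monotoneOn hF) hs.1)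
  rw [capCdf, if_neg (not_le.2 hs.1), if_pos hs.2, one_div]
  have hcast : ((n : ℝ) - 1) = ((n - 1 : ℕ) : ℝ) := by
    rw [Nat.cast_sub (by omega), Nat.cast_one]
  rw [hcast]
  exact Real.rpow_inv_natCast_pow hr (by omega)

/-- Here x and y play H_n(s) and H_{n+1}(s) with n = m + 1. For x > 0 the hypothesis says
(y/x)^(m+1) = 1/x, and Bernoulli's inequality bounds this below by 1 + (m+1)(y/x - 1); multiply by
x. -/
theorem pow_comparison {x y : ℝ} {m : ℕ} (hx : x ∈ Icc (0 : ℝ) 1)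
    (hy : y ∈ Icc (0 : ℝ) 1) (h : x ^ m = y ^ (m + 1)) (hm : m ≠ 0) :
    x ≤ y ∧ 0 ≤ x ^ m * (1 + m * x - (m + 1) * y) := by
  have hxy : x ≤ y := by
    by_contra! hlt
    have h1 : y ^ (m + 1) ≤ y ^ m := pow_le_pow_of_le_one hy.1 hy.2 (Nat.le_succ m)
    have h2 : y ^ m < x ^ m := pow_lt_pow_left₀ hlt hy.1 hm
    linarith
  refine ⟨hxy, ?_⟩
  rcases hx.1.eq_or_lt with h0 | h0
  · rw [← h0, zero_pow hm, zero_mul]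
  · refine mul_nonneg (pow_nonneg hx.1 m) ?_
    have hb := one_add_mul_le_pow (a := y / x - 1) (by
      have : 0 ≤ y / x := div_nonneg hy.1 hx.1
      linarith) (m + 1)
    have e1 : (1 + (y / x - 1)) ^ (m + 1) = 1 / x := by
      rw [add_sub_cancel, div_pow, ← h, pow_succ]
      field_simp
    rw [e1] at hb
    have hb' := mul_le_mul_of_nonneg_right hb hx.1
    have e2 : (1 + ((m + 1 : ℕ) : ℝ) * (y / x - 1)) * x = x + (m + 1) * (y - x) := by
      push_cast
      field_simp
    rw [e2, one_div, inv_mul_cancel₀ h0.ne'] at hb'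
    linarith

/-- For s in (0, q^M] both distribution functions are r times an expression linear in the individual
one, with r = c'(s)/V'(s) common to n and n + 1. So an additional firm lowers both order statistics
stochastically. -/
theorem cdf_comparison (hF : RegularTypes F) (hg : ConcaveUtility g)
    (hc : StrictConvexOn ℝ (Ici 0) c) (hcm : MonotoneOn c (Ici 0)) (hn : 2 ≤ n)
    {ν' : Measure ℝ} (hq : IsMonopolyCap F g c qM) (h : IsCapLaw F g c n ν)
    (h' : IsCapLaw F g c (n + 1) ν') (s : ℝ) :
    (highestLaw n ν).real (Iic s) ≤ (highestLaw (n + 1) ν').real (Iic s) ∧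
      (secondLaw n ν).real (Iic s) ≤ (secondLaw (n + 1) ν').real (Iic s) := by
  have := h.1
  have := h'.1
  rw [highestLaw_real_Iic ν (by omega), highestLaw_real_Iic ν' (by omega),
    secondLaw_real_Iic ν hn, secondLaw_real_Iic ν' (by omega)]
  obtain ⟨m, rfl⟩ : ∃ m, n = m + 1 := ⟨n - 1, by omega⟩
  have hm : m ≠ 0 := by omega
  have e := h.real_Iic_eq hF hg hc hq s
  have e' := h'.real_Iic_eq hF hg hc hq s
  by_cases h0 : s ≤ 0
  · rw [capCdf, if_pos h0] at e e'
    simp [e, e', hm]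
  by_cases h1 : s ≤ qM
  · have hx : ν.real (Iic s) ∈ Icc (0 : ℝ) 1 := ⟨measureReal_nonneg, measureReal_le_one⟩
    have hy : ν'.real (Iic s) ∈ Icc (0 : ℝ) 1 := ⟨measureReal_nonneg, measureReal_le_one⟩
    have hpow : ν.real (Iic s) ^ m = ν'.real (Iic s) ^ (m + 1) := by
      have p1 := capCdf_pow (n := m + 1) hF hg hcm hn ⟨not_le.1 h0, h1⟩
      have p2 := capCdf_pow (n := m + 1 + 1) hF hg hcm (by omega) ⟨not_le.1 h0, h1⟩
      rw [e, e']
      exact p1.trans p2.symm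
    obtain ⟨hle, hpos⟩ := pow_comparison hx hy hpow hm
    have hxm := pow_nonneg hx.1 m
    constructor
    · rw [pow_succ, pow_succ _ (m + 1), ← hpow]
      exact mul_le_mul_of_nonneg_left hle hxm
    · simp only [Nat.add_sub_cancel]
      push_cast
      rw [pow_succ (ν.real (Iic s)) m, pow_succ (ν'.real (Iic s)) (m + 1), ← hpow]
      linarith
  · rw [capCdf, if_neg h0, if_neg h1] at e e'
    simp [e, e']

theorem intervalIntegrable_mul_of_antitone {f G : ℝ → ℝ} {M : ℝ}
    (hf : IntervalIntegrable f volume 0 M) (hG : Antitone G) (hb : ∀ s, |G s| ≤ 1) :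
    IntervalIntegrable (fun s => f s * G s) volume 0 M := by
  rw [intervalIntegrable_iff] at hf ⊢
  simp only [mul_comm (f _)]
  exact Integrable.bdd_mul hf hG.measurable.aestronglyMeasurable (ae_of_all _ hb)

theorem intervalIntegrable_mul_tail {f : ℝ → ℝ} {M : ℝ} (hf : IntervalIntegrable f volume 0 M)
    (μ : Measure ℝ) [IsProbabilityMeasure μ] :
    IntervalIntegrable (fun s => f s * (1 - μ.real (Iic s))) volume 0 M := by
  refine intervalIntegrable_mul_of_antitone hf
    (fun x y hxy => sub_le_sub_left (measureReal_mono (Iic_subset_Iic.2 hxy)) 1) fun s => ?_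
  have h0 : 0 ≤ μ.real (Iic s) := measureReal_nonneg
  have h1 : μ.real (Iic s) ≤ 1 := measureReal_le_one
  exact abs_le.2 ⟨by linarith, by linarith⟩

/-- Zero profits: expected investments equal the expected revenue of the best firm. -/
theorem IsCapLaw.zero_profit (hF : RegularTypes F) (hg : ConcaveUtility g)
    (hc : RegularCost c) (hn : 2 ≤ n) (hq : IsMonopolyCap F g c qM) (h : IsCapLaw F g c n ν) :
    ∫ x, revenue F g x ∂(highestLaw n ν) - ∫ x, revenue F g x ∂(secondLaw n ν) =
      n * (∫ x, c x ∂ν - c 0) := by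
  have := h.1
  have hn0 : 0 < n := by omega
  have := isProbabilityMeasure_highestLaw ν hn0
  have := isProbabilityMeasure_secondLaw ν hn
  have hν := h.ae_mem hF hg hc.strictConvex hq
  have hsub : Icc 0 qM ⊆ Ici 0 := Icc_subset_Ici_self
  have hVm := hg.revenue_monotoneOn hF
  have hcm := hc.strictMono.monotoneOn
  have hV' := intervalIntegrable_deriv_of_monotoneOn hVm le_rfl hq.1
  have hc' := intervalIntegrable_deriv_of_monotoneOn hcm le_rfl hq.1
  have hVftc : ∀ x ∈ Icc 0 qM, ∫ s in (0 : ℝ)..x, deriv (revenue F g) s =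
      revenue F g x - revenue F g 0 := fun x hx =>
    integral_deriv_of_concaveOn (hg.revenue_concaveOn hF) hVm (hg.revenue_continuousOn hF) hx.1
  have hcftc : ∀ x ∈ Icc 0 qM, ∫ s in (0 : ℝ)..x, deriv c s = c x - c 0 := fun x hx =>
    intervalIntegral.integral_eq_sub_of_hasDerivAt_of_le hx.1
      (hc.differentiable.continuousOn.mono Icc_subset_Ici_self)
      (fun y hy => ((hc.differentiable y hy.1.le).differentiableAt (Ici_mem_nhds hy.1)).hasDerivAt)
      (intervalIntegrable_deriv_of_monotoneOn hcm le_rfl hx.1)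
  rw [integral_eq_add_integral_tail hq.1 (ae_highestLaw_mem hn0 hν)
      (integrable_of_monotoneOn_Icc hq.1 (ae_highestLaw_mem hn0 hν) (hVm.mono hsub)) hV' hVftc,
    integral_eq_add_integral_tail hq.1 (ae_secondLaw_mem hn hν)
      (integrable_of_monotoneOn_Icc hq.1 (ae_secondLaw_mem hn hν) (hVm.mono hsub)) hV' hVftc,
    integral_eq_add_integral_tail hq.1 hν
      (integrable_of_monotoneOn_Icc hq.1 hν (hcm.mono hsub)) hc' hcftc,
    add_sub_add_left_eq_sub, add_sub_cancel_left,
    ← intervalIntegral.integral_sub (intervalIntegrable_mul_tail hV' _)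
      (intervalIntegrable_mul_tail hV' _), ← intervalIntegral.integral_const_mul]
  refine intervalIntegral.integral_congr_ae ?_
  filter_upwards [ae_differentiableAt_of_monotoneOn hVm] with s hd hs
  rw [uIoc_of_le hq.1] at hs
  have hpos := deriv_pos_of_concaveOn (hg.revenue_concaveOn hF) (hg.revenue_strictMonoOn hF) hs.1
    (hd hs.1)
  -- With H = H_n(s), the two tails differ by n H^(n-1)(1 - H). Since V' H^(n-1) = c' at almost
  -- every s, V' times this difference is n c'(1 - H), the integrand for the costs.
  have hpow := capCdf_pow (n := n) hF hg hcm hn hs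
  rw [← h.real_Iic_eq hF hg hc.strictConvex hq, eq_div_iff hpos.ne'] at hpow
  rw [highestLaw_real_Iic ν hn0, secondLaw_real_Iic ν hn]
  obtain ⟨m, rfl⟩ : ∃ m, n = m + 1 := ⟨n - 1, by omega⟩
  rw [Nat.add_sub_cancel] at hpow ⊢
  rw [← hpow, pow_succ]
  push_cast
  ring

end Equilibrium

/-! ### Welfare falls with the number of firms -/

section Comparison
variable {F g c : ℝ → ℝ} {n : ℕ} {ν ν' : Measure ℝ} {qM : ℝ}

theorem IsMonopolyCap.surplus_sub_cost_monotoneOn (hF : RegularTypes F) (hg : ConcaveUtility g)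
    (hc : StrictConvexOn ℝ (Ici 0) c) (hq : IsMonopolyCap F g c qM) :
    MonotoneOn (fun x => truncatedSurplus F g x - c x) (Icc 0 qM) := by
  intro x hx y hy hxy
  have h1 := hq.monotoneOn hF hg hc hx hy hxy
  have h2 := hg.informationRent_monotoneOn hF hx.1 hy.1 hxy
  simp only [hg.truncatedSurplus_eq hF hx.1, hg.truncatedSurplus_eq hF hy.1] at h1 ⊢
  linarith

theorem IsCapLaw.expectedWelfare_succ_le (hF : RegularTypes F) (hg : ConcaveUtility g)
    (hc : StrictConvexOn ℝ (Ici 0) c) (hcm : MonotoneOn c (Ici 0)) (hn : 2 ≤ n)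
    (hq : IsMonopolyCap F g c qM) (h : IsCapLaw F g c n ν) (h' : IsCapLaw F g c (n + 1) ν') :
    expectedWelfare F g c (n + 1) ν' ≤ expectedWelfare F g c n ν := by
  have := h.1
  have := h'.1
  have hν := h.ae_mem hF hg hc hq
  have hν' := h'.ae_mem hF hg hc hq
  have := isProbabilityMeasure_highestLaw ν (n := n) (by omega)
  have := isProbabilityMeasure_secondLaw ν hn
  have := isProbabilityMeasure_highestLaw ν' (n := n + 1) (by omega)
  have := isProbabilityMeasure_secondLaw ν' (n := n + 1) (by omega)
  rw [hg.expectedWelfare_eq hF hcm hn hq.1 hν, hg.expectedWelfare_eq hF hcm (by omega) hq.1 hν']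
  refine add_le_add ?_ ?_
  · exact integral_le_of_cdf_le_of_monotoneOn hq.1 (ae_highestLaw_mem (by omega) hν)
      (ae_highestLaw_mem (by omega) hν') (fun s => (cdf_comparison hF hg hc hcm hn hq h h' s).1)
      (hq.surplus_sub_cost_monotoneOn hF hg hc)
  · exact integral_le_of_cdf_le_of_monotoneOn hq.1 (ae_secondLaw_mem hn hν)
      (ae_secondLaw_mem (by omega) hν') (fun s => (cdf_comparison hF hg hc hcm hn hq h h' s).2)
      ((hg.floorGain_monotoneOn hF).mono Icc_subset_Ici_self)

/-- After the investments are paid, only the second-highest cap earns revenue. -/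
theorem IsCapLaw.expectedNetSurplus_eq (hF : RegularTypes F) (hg : ConcaveUtility g)
    (hc : RegularCost c) (hn : 2 ≤ n) (hq : IsMonopolyCap F g c qM) (h : IsCapLaw F g c n ν) :
    expectedNetSurplus F g c n ν = ∫ x, informationRent F g x ∂(highestLaw n ν) +
      ∫ y, (revenue F g y + floorGain F g y) ∂(secondLaw n ν) - n * c 0 := by
  have := h.1
  have hn0 : 0 < n := by omega
  have hν := h.ae_mem hF hg hc.strictConvex hq
  have := isProbabilityMeasure_highestLaw ν hn0
  have := isProbabilityMeasure_secondLaw ν hn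
  have hsub : Icc 0 qM ⊆ Ici 0 := Icc_subset_Ici_self
  have hH := ae_highestLaw_mem hn0 hν
  have hS := ae_secondLaw_mem hn hν
  have hVm := (hg.revenue_monotoneOn hF).mono hsub
  have hz := h.zero_profit hF hg hc hn hq
  have e : ∫ x, truncatedSurplus F g x ∂(highestLaw n ν) =
      ∫ x, revenue F g x ∂(highestLaw n ν) + ∫ x, informationRent F g x ∂(highestLaw n ν) := by
    rw [← integral_add (integrable_of_monotoneOn_Icc hq.1 hH hVm)
      (integrable_of_monotoneOn_Icc hq.1 hH ((hg.informationRent_monotoneOn hF).mono hsub))]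
    exact integral_congr_ae (hH.mono fun x hx => hg.truncatedSurplus_eq hF hx.1)
  rw [hg.expectedNetSurplus_eq hF hc.strictMono.monotoneOn hn hq.1 hν, e,
    integral_add (integrable_of_monotoneOn_Icc hq.1 hS hVm)
      (integrable_of_monotoneOn_Icc hq.1 hS ((hg.floorGain_monotoneOn hF).mono hsub))]
  linarith

/-- After zero profits are used, R is evaluated at the highest cap and V + D at the second, both
nondecreasing. The remaining term n c(0) grows with n because c(0) ≥ 0; it is not assumed to vanish.
-/
theorem IsCapLaw.expectedNetSurplus_succ_le (hF : RegularTypes F) (hg : ConcaveUtility g)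
    (hc : RegularCost c) (hn : 2 ≤ n) (hq : IsMonopolyCap F g c qM) (h : IsCapLaw F g c n ν)
    (h' : IsCapLaw F g c (n + 1) ν') :
    expectedNetSurplus F g c (n + 1) ν' ≤ expectedNetSurplus F g c n ν := by
  have := h.1
  have := h'.1
  have hcs := hc.strictConvex
  have hcm := hc.strictMono.monotoneOn
  have hν := h.ae_mem hF hg hcs hq
  have hν' := h'.ae_mem hF hg hcs hq
  have := isProbabilityMeasure_highestLaw ν (n := n) (by omega)
  have := isProbabilityMeasure_secondLaw ν hn
  have := isProbabilityMeasure_highestLaw ν' (n := n + 1) (by omega)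
  have := isProbabilityMeasure_secondLaw ν' (n := n + 1) (by omega)
  rw [h.expectedNetSurplus_eq hF hg hc hn hq, h'.expectedNetSurplus_eq hF hg hc (by omega) hq]
  refine sub_le_sub (add_le_add ?_ ?_) ?_
  · exact integral_le_of_cdf_le_of_monotoneOn hq.1 (ae_highestLaw_mem (by omega) hν)
      (ae_highestLaw_mem (by omega) hν') (fun s => (cdf_comparison hF hg hcs hcm hn hq h h' s).1)
      ((hg.informationRent_monotoneOn hF).mono Icc_subset_Ici_self)
  · exact integral_le_of_cdf_le_of_monotoneOn hq.1 (ae_secondLaw_mem hn hν)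
      (ae_secondLaw_mem (by omega) hν') (fun s => (cdf_comparison hF hg hcs hcm hn hq h h' s).2)
      (((hg.revenue_monotoneOn hF).add (hg.floorGain_monotoneOn hF)).mono Icc_subset_Ici_self)
  · exact mul_le_mul_of_nonneg_right (by push_cast; linarith) (hc.nonneg 0 le_rfl)

end Comparison

/-! ### Full bunching: monopoly beats duopoly -/

section Bunching
variable {F g c A : ℝ → ℝ} {ν : Measure ℝ} {qM : ℝ}

/-- Multiplying θ - φ(θ) by the density leaves 1 - F, which is positive on (0,1). -/
theorem RegularTypes.integral_rent_pos (hF : RegularTypes F) :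
    0 < ∫ θ, (θ - virtualValue F θ) ∂(typeLaw F) := by
  have huIcc : uIcc (0 : ℝ) 1 = Θ := uIcc_of_le zero_le_one
  rw [hF.integral_typeLaw]
  have : ∫ θ in (0 : ℝ)..1, density F θ * (θ - virtualValue F θ) =
      ∫ θ in (0 : ℝ)..1, (1 - F θ) := by
    refine intervalIntegral.integral_congr fun θ hθ => ?_
    rw [huIcc] at hθ
    linear_combination -hF.virtualValue_mul_density hθ
  rw [this]
  refine intervalIntegral.intervalIntegral_pos_of_pos_on (ContinuousOn.intervalIntegrable ?_)
    (fun θ hθ => ?_) one_pos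
  · rw [huIcc]
    exact continuousOn_const.sub hF.differentiable.continuousOn
  · rw [sub_pos]
    exact (hF.strictMonoOn (Ioo_subset_Icc_self hθ) one_mem_types hθ.2).trans_eq hF.map_one

/-- By concavity V(q) ≥ q V(1) on [0,1], whereas c(q) - c(0) = o(q) because c'(0) = 0; a small
investment is profitable. -/
theorem IsMonopolyCap.pos (hF : RegularTypes F) (hg : ConcaveUtility g) (hc : RegularCost c)
    (hq : IsMonopolyCap F g c qM) : 0 < qM := by
  refine lt_of_le_of_ne hq.1 fun h0 => ?_
  subst h0
  have hV1 : 0 < revenue F g 1 := by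
    rw [← hg.revenue_zero hF]
    exact hg.revenue_strictMonoOn hF self_mem_Ici (mem_Ici.2 zero_le_one) one_pos
  have hslope := (hasDerivWithinAt_iff_tendsto_slope' (s := Ioi (0 : ℝ)) (by simp)).1
    (hc.inada_zero.mono
    (Ioi_subset_Ici_self (a := (0 : ℝ))))
  obtain ⟨q, hq1, hq2⟩ := ((hslope.eventually (gt_mem_nhds hV1)).and
    (Ioc_mem_nhdsGT (one_pos (α := ℝ)))).exists
  have h1 := hq.2 q hq2.1.le
  have h2 := (hg.revenue_concaveOn hF).2 (self_mem_Ici (a := (0 : ℝ)))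
    (mem_Ici.2 (zero_le_one (α := ℝ))) (sub_nonneg.2 hq2.2) hq2.1.le (by ring)
  simp only [smul_eq_mul, mul_zero, mul_one, zero_add, hg.revenue_zero hF] at h1 h2
  rw [slope_def_field, sub_zero, div_lt_iff₀ hq2.1] at hq1
  linarith

theorem RegularCost.deriv_pos (hc : RegularCost c) {s : ℝ} (hs : 0 < s) : 0 < deriv c s := by
  refine lt_of_lt_of_le ?_ (hc.strictConvex.convexOn.slope_le_deriv self_mem_Ici
    (mem_Ici.2 hs.le) hs ((hc.differentiable s hs.le).differentiableAt (Ici_mem_nhds hs)))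
  rw [slope_def_field]
  exact div_pos (sub_pos.2 (hc.strictMono self_mem_Ici (mem_Ici.2 hs.le) hs)) (by simpa using hs)

theorem exists_mem_Ioo_of_ae {p : ℝ → Prop} (h : ∀ᵐ x, p x) {a b : ℝ} (hab : a < b) :
    ∃ x ∈ Ioo a b, p x := by
  by_contra! hcon
  have h0 : volume (Ioo a b) = 0 := measure_mono_null (fun x hx => hcon x hx) (ae_iff.1 h)
  rw [Real.volume_Ioo, ENNReal.ofReal_eq_zero] at h0
  linarith

/-- The highest cap falls short of the monopoly cap with positive probability. -/
theorem IsCapLaw.integral_highest_lt (hF : RegularTypes F) (hg : ConcaveUtility g)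
    (hc : RegularCost c) (hq : IsMonopolyCap F g c qM) (h : IsCapLaw F g c 2 ν) :
    ∫ x, x ∂(highestLaw 2 ν) < qM := by
  have := h.1
  have := isProbabilityMeasure_highestLaw ν (n := 2) (by omega)
  have hH := ae_highestLaw_mem (n := 2) (by omega) (h.ae_mem hF hg hc.strictConvex hq)
  have hint : Integrable (fun x : ℝ => x) (highestLaw 2 ν) :=
    integrable_of_monotoneOn_Icc hq.1 hH monotoneOn_id
  have hnn : 0 ≤ᵐ[highestLaw 2 ν] fun x => qM - x := hH.mono fun x hx => sub_nonneg.2 hx.2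
  have hle := integral_nonneg_of_ae hnn
  have e : ∫ x, (qM - x) ∂(highestLaw 2 ν) = qM - ∫ x, x ∂(highestLaw 2 ν) := by
    rw [integral_sub (integrable_const _) hint]
    simp
  rw [e] at hle
  refine lt_of_le_of_ne (sub_nonneg.1 hle) fun heq => ?_
  have hae := (integral_eq_zero_iff_of_nonneg_ae hnn ((integrable_const _).sub hint)).1
    (by rw [e, heq, sub_self])
  -- At a point s < q^M where V is differentiable, each cap is at most s with probability
  -- c'(s)/V'(s) > 0, which excludes that the highest cap equals q^M almost surely.
  obtain ⟨s, hs, hd⟩ := exists_mem_Ioo_of_ae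
    (ae_differentiableAt_of_monotoneOn (hg.revenue_monotoneOn hF)) (hq.pos hF hg hc)
  have hV := deriv_pos_of_concaveOn (hg.revenue_concaveOn hF) (hg.revenue_strictMonoOn hF) hs.1
    (hd hs.1)
  have hpow := capCdf_pow (n := 2) (c := c) hF hg hc.strictMono.monotoneOn le_rfl ⟨hs.1, hs.2.le⟩
  rw [← h.real_Iic_eq hF hg hc.strictConvex hq] at hpow
  have hpos : 0 < (highestLaw 2 ν).real (Iic s) := by
    rw [highestLaw_real_Iic ν (by omega)]
    refine pow_pos ?_ 2
    simp only [Nat.add_one_sub_one, pow_one] at hpow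
    rw [hpow]
    exact div_pos (hc.deriv_pos hs.1) hV
  have hzero : (highestLaw 2 ν) (Iic s) = 0 := by
    refine measure_mono_null (fun x (hx : x ≤ s) => ?_) (ae_iff.1 hae)
    have : x < qM := hx.trans_lt hs.2
    exact (sub_pos.2 this).ne'
  rw [measureReal_def, hzero] at hpos
  simp at hpos

theorem truncatedMaximizer_of_bunching (hF : RegularTypes F) (hg : ConcaveUtility g)
    (hb : ENNReal.ofReal qM ≤ virtualMaximizer F g 0) {x θ : ℝ} (hx : x ∈ Icc 0 qM)
    (hθ : θ ∈ Θ) : truncatedMaximizer F g x θ = x := by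
  refine le_antisymm (truncatedMaximizer_le hx.1) ?_
  have h0 : truncatedMaximizer F g x 0 = x := by
    rw [truncatedMaximizer, min_eq_right ((ENNReal.ofReal_le_ofReal hx.2).trans hb),
      ENNReal.toReal_ofReal hx.1]
  exact h0.ge.trans (hg.truncatedMaximizer_monotoneOn hF hx.1 zero_mem_types hθ hθ.1)

/-- All types receive the cap, so D = 0 and R(x) = μx with μ > 0. Since V - c is maximal at q^M,
duopoly loses at least μ times the expected shortfall of the highest cap. -/
theorem expectedWelfare_lt_of_bunching (hF : RegularTypes F) (hg : ConcaveUtility g)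
    (hc : RegularCost c) (hq : IsMonopolyCap F g c qM) (hA : IsMonopolist F g c A)
    (h : IsCapLaw F g c 2 ν) (hb : ENNReal.ofReal qM ≤ virtualMaximizer F g 0) :
    expectedWelfare F g c 2 ν < welfare F g c A := by
  have := h.1
  have := isProbabilityMeasure_highestLaw ν (n := 2) (by omega)
  have hν := h.ae_mem hF hg hc.strictConvex hq
  have hH := ae_highestLaw_mem (n := 2) (by omega) hν
  have hS := ae_secondLaw_mem (n := 2) le_rfl hν
  rw [hA.welfare_eq hF hg hc.strictConvex hq,
    hg.expectedWelfare_eq hF hc.strictMono.monotoneOn le_rfl hq.1 hν]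
  have hD : ∫ y, floorGain F g y ∂(secondLaw 2 ν) = 0 := by
    refine integral_eq_zero_of_ae (hS.mono fun y hy => ?_)
    refine integral_eq_zero_of_ae ((ae_typeLaw_mem F).mono fun θ hθ => ?_)
    simp [truncatedMaximizer_of_bunching hF hg hb hy hθ]
  set μ := ∫ θ, (θ - virtualValue F θ) ∂(typeLaw F) with hμ
  have hR : ∀ x ∈ Icc 0 qM, informationRent F g x = μ * x := by
    intro x hx
    rw [hμ, ← integral_mul_const]
    exact integral_congr_ae ((ae_typeLaw_mem F).mono fun θ hθ => by
      simp only [truncatedMaximizer_of_bunching hF hg hb hx hθ])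
  have hint : Integrable (fun x : ℝ => x) (highestLaw 2 ν) :=
    integrable_of_monotoneOn_Icc hq.1 hH monotoneOn_id
  have hbound : ∫ x, (truncatedSurplus F g x - c x) ∂(highestLaw 2 ν) ≤
      ∫ x, (truncatedSurplus F g qM - c qM - μ * (qM - x)) ∂(highestLaw 2 ν) := by
    refine integral_mono_ae (integrable_of_monotoneOn_Icc hq.1 hH
      (hq.surplus_sub_cost_monotoneOn hF hg hc.strictConvex))
      ((integrable_const _).sub (((integrable_const _).sub hint).const_mul μ))
      (hH.mono fun x hx => ?_)
    have h1 := hq.2 x hx.1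
    simp only [hg.truncatedSurplus_eq hF hx.1, hg.truncatedSurplus_eq hF hq.1, hR x hx,
      hR qM (right_mem_Icc.2 hq.1)]
    linarith
  have hi : Integrable (fun x : ℝ => μ * (qM - x)) (highestLaw 2 ν) :=
    ((integrable_const _).sub hint).const_mul μ
  rw [integral_sub (integrable_const _) hi, integral_const_mul,
    integral_sub (integrable_const _) hint] at hbound
  simp only [integral_const, probReal_univ, one_smul] at hbound
  have hlt := h.integral_highest_lt hF hg hc hq
  have := mul_pos hF.integral_rent_pos (sub_pos.2 hlt)
  rw [hD]
  linarith

end Bunching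

/-! ### Power costs as the exponent grows -/

section PowerCost
variable {a α : ℝ}

theorem powerCost_strictConvexOn (ha : 0 < a) (hα : 1 < α) :
    StrictConvexOn ℝ (Ici 0) (powerCost a α) := by
  refine ⟨convex_Ici 0, fun x hx y hy hxy s t hs ht hst => ?_⟩
  have h := (strictConvexOn_rpow hα).2 (mem_Ici.2 (div_nonneg hx ha.le))
    (mem_Ici.2 (div_nonneg hy ha.le)) (fun h => hxy ((div_left_inj' ha.ne').1 h)) hs ht hst
  have e : (s • x + t • y) / a = s • (x / a) + t • (y / a) := by
    simp only [smul_eq_mul]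
    ring
  rw [powerCost, e]
  exact h

theorem powerCost_monotoneOn (ha : 0 < a) (hα : 1 < α) : MonotoneOn (powerCost a α) (Ici 0) :=
  fun _ hx _ _ hxy => Real.rpow_le_rpow (div_nonneg hx ha.le)
    (div_le_div_of_nonneg_right hxy ha.le) (zero_lt_one.trans hα).le

theorem powerCost_nonneg (ha : 0 < a) {q : ℝ} (hq : 0 ≤ q) : 0 ≤ powerCost a α q :=
  Real.rpow_nonneg (div_nonneg hq ha.le) α

theorem powerCost_zero (a : ℝ) (hα : 1 < α) : powerCost a α 0 = 0 := by
  rw [powerCost, zero_div, Real.zero_rpow (zero_lt_one.trans hα).ne']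

theorem tendsto_powerCost_zero (ha : 0 < a) {q : ℝ} (hq : 0 ≤ q) (hqa : q < a) :
    Tendsto (fun α => powerCost a α q) atTop (𝓝 0) :=
  tendsto_rpow_atTop_of_base_lt_one _ (by linarith [div_nonneg hq ha.le])
    ((div_lt_one ha).2 hqa)

theorem tendsto_powerCost_atTop (ha : 0 < a) {q : ℝ} (hqa : a < q) :
    Tendsto (fun α => powerCost a α q) atTop atTop :=
  tendsto_rpow_atTop_of_base_gt_one _ ((one_lt_div ha).2 hqa)

/-- By convexity the derivative is at most the chord slope to some q' in (q, a), where the cost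
itself vanishes in the limit. -/
theorem tendsto_deriv_powerCost (ha : 0 < a) {q : ℝ} (hq : 0 < q) (hqa : q < a) :
    Tendsto (fun α => deriv (powerCost a α) q) atTop (𝓝 0) := by
  obtain ⟨q', hqq', hq'a⟩ := exists_between hqa
  have hq' := hq.trans hqq'
  have hlim : Tendsto (fun α => powerCost a α q' / (q' - q)) atTop (𝓝 0) := by
    simpa using (tendsto_powerCost_zero ha hq'.le hq'a).div_const (q' - q)
  refine squeeze_zero' ?_ ?_ hlim
  · filter_upwards [eventually_gt_atTop 1] with α hα
    exact deriv_nonneg_of_monotoneOn_Ici (powerCost_monotoneOn ha hα) hq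
  · filter_upwards [eventually_gt_atTop 1] with α hα
    have hd : DifferentiableAt ℝ (powerCost a α) q :=
      (differentiableAt_id.div_const a).rpow_const (Or.inl (div_pos hq ha).ne')
    refine ((powerCost_strictConvexOn ha hα).convexOn.deriv_le_slope (mem_Ici.2 hq.le)
      (mem_Ici.2 hq'.le) hqq' hd).trans ?_
    rw [slope_def_field]
    exact div_le_div_of_nonneg_right (sub_le_self _ (powerCost_nonneg ha hq.le))
      (sub_pos.2 hqq').le

end PowerCost

/-! ### Limits of monopoly and duopoly as costs become fixed -/

section Limit
variable {F g : ℝ → ℝ} {a : ℝ}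

theorem exists_mem_Ioo_lt {ψ : ℝ → ℝ} (hψ : ContinuousOn ψ (Ici 0)) (ha : 0 < a) {b : ℝ}
    (hb : b < ψ a) : ∃ y ∈ Ioo 0 a, b < ψ y := by
  have hc : ContinuousAt ψ a := hψ.continuousAt (Ici_mem_nhds ha)
  have h1 : ∀ᶠ y in 𝓝[<] a, b < ψ y := (hc.mono_left nhdsWithin_le_nhds).eventually (lt_mem_nhds hb)
  obtain ⟨y, hy, hy'⟩ := (h1.and (Ioo_mem_nhdsLT ha)).exists
  exact ⟨y, hy', hy⟩

/-- With nearly fixed costs the monopoly cap is close to the capacity `a`. -/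
theorem tendsto_monopolyCap (hF : RegularTypes F) (hg : ConcaveUtility g) (ha : 0 < a)
    {q : ℝ → ℝ} (hq : ∀ α, 1 < α → IsMonopolyCap F g (powerCost a α) (q α)) :
    Tendsto q atTop (𝓝 a) := by
  refine tendsto_order.2 ⟨fun b hb => ?_, fun b hb => ?_⟩
  -- A cap of at most b would earn no more than V(max b 0) < V(y), while y < a becomes costless in
  -- the limit.
  · obtain ⟨y, hxy, hya⟩ := exists_between (max_lt hb ha)
    have hx : 0 ≤ max b 0 := le_max_right _ _
    have hV := hg.revenue_strictMonoOn hF hx (hx.trans hxy.le) hxy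
    have hlim : Tendsto (fun α => revenue F g y - powerCost a α y) atTop
        (𝓝 (revenue F g y - 0)) :=
      tendsto_const_nhds.sub (tendsto_powerCost_zero ha (hx.trans hxy.le) hya)
    rw [sub_zero] at hlim
    filter_upwards [eventually_gt_atTop 1, hlim.eventually (lt_mem_nhds hV)] with α hα hlt
    have h1 := (hq α hα).2 y (hx.trans hxy.le)
    have h2 := powerCost_nonneg (α := α) ha (hq α hα).1
    refine (le_max_left b 0).trans_lt ?_
    by_contra! hle
    have := hg.revenue_monotoneOn hF (hq α hα).1 hx hle
    linarith
  · have hlim := tendsto_powerCost_atTop ha hb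
    have hb0 := ha.trans hb
    filter_upwards [eventually_gt_atTop 1, hlim.eventually (eventually_gt_atTop (revenue F g b))]
      with α hα hlt
    by_contra! hle
    -- If b > a lay below the monopoly cap, concavity of profit would give V(b) - c(b) ≥ 0, although
    -- c(b) diverges.
    have hseg : b ∈ segment ℝ 0 (q α) := by
      rw [segment_eq_Icc (hq α hα).1]
      exact ⟨hb0.le, hle⟩
    have h1 := (hg.monopolyProfit_strictConcaveOn hF
      (powerCost_strictConvexOn ha hα)).concaveOn.min_le_of_mem_segment self_mem_Ici
      (mem_Ici.2 (hq α hα).1) hseg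
    have h2 := (hq α hα).2 0 le_rfl
    simp only [hg.revenue_zero hF, powerCost_zero a hα, sub_zero] at h1 h2
    rw [min_eq_left h2] at h1
    linarith

/-- With nearly fixed costs the monopolist's investment costs vanish. -/
theorem tendsto_cost_monopolyCap (hF : RegularTypes F) (hg : ConcaveUtility g) (ha : 0 < a)
    {q : ℝ → ℝ} (hq : ∀ α, 1 < α → IsMonopolyCap F g (powerCost a α) (q α)) :
    Tendsto (fun α => powerCost a α (q α)) atTop (𝓝 0) := by
  have hVc := hg.revenue_continuousOn hF
  refine tendsto_order.2 ⟨fun b hb => ?_, fun e he => ?_⟩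
  · filter_upwards [eventually_gt_atTop 1] with α hα
    exact hb.trans_le (powerCost_nonneg ha (hq α hα).1)
  -- Optimality against y gives c(q^M) ≤ V(q^M) - V(y) + c(y), whose limit V(a) - V(y) is below e
  -- for y close to a.
  · obtain ⟨y, hy, hVy⟩ := exists_mem_Ioo_lt hVc ha (sub_lt_self (revenue F g a) he)
    have hlim : Tendsto (fun α => revenue F g (q α) - revenue F g y + powerCost a α y) atTop
        (𝓝 (revenue F g a - revenue F g y + 0)) :=
      (((hVc.continuousAt (Ici_mem_nhds ha)).tendsto.comp
        (tendsto_monopolyCap hF hg ha hq)).sub_const _).add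
        (tendsto_powerCost_zero ha hy.1.le hy.2)
    filter_upwards [eventually_gt_atTop 1,
      hlim.eventually (gt_mem_nhds (by linarith : revenue F g a - revenue F g y + 0 < e))]
      with α hα hlt
    have := (hq α hα).2 y hy.1.le
    linarith

/-- With nearly fixed costs the caps of duopolists concentrate at the capacity `a`. -/
theorem tendsto_capLaw_Iic (hF : RegularTypes F) (hg : ConcaveUtility g) (ha : 0 < a)
    {q : ℝ → ℝ} (hq : ∀ α, 1 < α → IsMonopolyCap F g (powerCost a α) (q α)) {ν : ℝ → Measure ℝ}
    (hν : ∀ α, 1 < α → IsCapLaw F g (powerCost a α) 2 (ν α)) {x : ℝ} (hx : x ∈ Ioo 0 a) :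
    Tendsto (fun α => (ν α).real (Iic x)) atTop (𝓝 0) := by
  have hlim : Tendsto (fun α => deriv (powerCost a α) x / deriv (revenue F g) x) atTop (𝓝 0) := by
    simpa using (tendsto_deriv_powerCost ha hx.1 hx.2).div_const (deriv (revenue F g) x)
  refine hlim.congr' ?_
  filter_upwards [eventually_gt_atTop 1,
    (tendsto_monopolyCap hF hg ha hq).eventually (lt_mem_nhds hx.2)] with α hα hxq
  have h := capCdf_pow (n := 2) hF hg (powerCost_monotoneOn ha hα) le_rfl ⟨hx.1, hxq.le⟩
  rw [(hν α hα).real_Iic_eq hF hg (powerCost_strictConvexOn ha hα) (hq α hα), ← h]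
  simp

/-- From below, ψ ≥ 0 gives a Markov bound ψ(y) P(X > y) with y just under a; from above, the
integral is at most ψ at the top of the support, which tends to a. -/
theorem tendsto_integral_of_concentrates (ha : 0 < a) {q : ℝ → ℝ} (hq : Tendsto q atTop (𝓝 a))
    {μ : ℝ → Measure ℝ} (hμ : ∀ α, 1 < α → IsProbabilityMeasure (μ α))
    (hq0 : ∀ α, 1 < α → 0 ≤ q α) (hmem : ∀ α, 1 < α → ∀ᵐ x ∂(μ α), x ∈ Icc 0 (q α))
    (hlim : ∀ x ∈ Ioo 0 a, Tendsto (fun α => (μ α).real (Iic x)) atTop (𝓝 0)) {ψ : ℝ → ℝ}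
    (hψm : MonotoneOn ψ (Ici 0)) (hψc : ContinuousOn ψ (Ici 0)) (hψ0 : ∀ x, 0 ≤ x → 0 ≤ ψ x) :
    Tendsto (fun α => ∫ x, ψ x ∂(μ α)) atTop (𝓝 (ψ a)) := by
  have hint : ∀ α, 1 < α → Integrable ψ (μ α) := fun α hα => by
    have := hμ α hα
    exact integrable_of_monotoneOn_Icc (hq0 α hα) (hmem α hα) (hψm.mono Icc_subset_Ici_self)
  refine tendsto_order.2 ⟨fun b hb => ?_, fun b hb => ?_⟩
  · obtain ⟨y, hy, hby⟩ := exists_mem_Ioo_lt hψc ha hb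
    have h1 : Tendsto (fun α => ψ y * (1 - (μ α).real (Iic y))) atTop (𝓝 (ψ y * (1 - 0))) :=
      ((hlim y hy).const_sub 1).const_mul _
    rw [sub_zero, mul_one] at h1
    filter_upwards [eventually_gt_atTop 1, h1.eventually (lt_mem_nhds hby)] with α hα hlt
    have := hμ α hα
    refine hlt.trans_le ?_
    have e : ψ y * (1 - (μ α).real (Iic y)) = ∫ x, (Ioi y).indicator (fun _ => ψ y) x ∂(μ α) := by
      rw [integral_indicator_const _ measurableSet_Ioi, ← compl_Iic,
        measureReal_compl measurableSet_Iic, probReal_univ, smul_eq_mul, mul_comm]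
    rw [e]
    refine integral_mono_ae ((integrable_const _).indicator measurableSet_Ioi) (hint α hα)
      ((hmem α hα).mono fun x hx => ?_)
    by_cases hxy : x ∈ Ioi y
    · simp only [indicator_of_mem hxy]
      exact hψm hy.1.le hx.1 (le_of_lt hxy)
    · simp only [indicator_of_notMem hxy]
      exact hψ0 x hx.1
  · have h1 : Tendsto (fun α => ψ (q α)) atTop (𝓝 (ψ a)) :=
      (hψc.continuousAt (Ici_mem_nhds ha)).tendsto.comp hq
    filter_upwards [eventually_gt_atTop 1, h1.eventually (gt_mem_nhds hb)] with α hα hlt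
    have := hμ α hα
    refine lt_of_le_of_lt ?_ hlt
    have := integral_mono_ae (hint α hα) (integrable_const (ψ (q α)))
      ((hmem α hα).mono fun x hx => hψm hx.1 (hq0 α hα) hx.2)
    simpa using this

theorem exists_monopolyCaps {ν : ℝ → Measure ℝ}
    (hν : ∀ α, 1 < α → IsCapLaw F g (powerCost a α) 2 (ν α)) :
    ∃ q : ℝ → ℝ, ∀ α, 1 < α → IsMonopolyCap F g (powerCost a α) (q α) := by
  have : ∀ α, ∃ q, 1 < α → IsMonopolyCap F g (powerCost a α) q := by
    intro α
    by_cases hα : 1 < α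
    · obtain ⟨q, hq, -⟩ := (hν α hα).2
      exact ⟨q, fun _ => hq⟩
    · exact ⟨0, fun h => absurd h hα⟩
  choose q hq using this
  exact ⟨q, hq⟩

theorem tendsto_monopolyWelfare (hF : RegularTypes F) (hg : ConcaveUtility g) (ha : 0 < a)
    {A : ℝ → ℝ → ℝ} {ν : ℝ → Measure ℝ}
    (hA : ∀ α, 1 < α → IsMonopolist F g (powerCost a α) (A α))
    (hν : ∀ α, 1 < α → IsCapLaw F g (powerCost a α) 2 (ν α)) :
    Tendsto (fun α => welfare F g (powerCost a α) (A α)) atTop (𝓝 (truncatedSurplus F g a)) := by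
  obtain ⟨q, hq⟩ := exists_monopolyCaps hν
  have h1 : Tendsto (fun α => truncatedSurplus F g (q α) - powerCost a α (q α)) atTop
      (𝓝 (truncatedSurplus F g a - 0)) :=
    (((hg.truncatedSurplus_continuousOn hF).continuousAt (Ici_mem_nhds ha)).tendsto.comp
      (tendsto_monopolyCap hF hg ha hq)).sub (tendsto_cost_monopolyCap hF hg ha hq)
  rw [sub_zero] at h1
  refine h1.congr' ?_
  filter_upwards [eventually_gt_atTop 1] with α hα
  exact ((hA α hα).welfare_eq hF hg (powerCost_strictConvexOn ha hα) (hq α hα)).symm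

/-- Both order statistics concentrate at a. Any firm's expected cost is at most the monopolist's,
which vanishes, so charging one firm or both gives the same limit. -/
theorem tendsto_duopolyWelfare (hF : RegularTypes F) (hg : ConcaveUtility g) (ha : 0 < a)
    {ν : ℝ → Measure ℝ} (hν : ∀ α, 1 < α → IsCapLaw F g (powerCost a α) 2 (ν α)) :
    Tendsto (fun α => expectedWelfare F g (powerCost a α) 2 (ν α)) atTop
        (𝓝 (truncatedSurplus F g a + floorGain F g a)) ∧
      Tendsto (fun α => expectedNetSurplus F g (powerCost a α) 2 (ν α)) atTop
        (𝓝 (truncatedSurplus F g a + floorGain F g a)) := by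
  obtain ⟨q, hq⟩ := exists_monopolyCaps hν
  have hqa := tendsto_monopolyCap hF hg ha hq
  have hq0 : ∀ α, 1 < α → 0 ≤ q α := fun α hα => (hq α hα).1
  have hprob : ∀ α, 1 < α → IsProbabilityMeasure (ν α) := fun α hα => (hν α hα).1
  have hmem : ∀ α, 1 < α → ∀ᵐ x ∂(ν α), x ∈ Icc 0 (q α) := fun α hα =>
    (hν α hα).ae_mem hF hg (powerCost_strictConvexOn ha hα) (hq α hα)
  have hG := fun x (hx : x ∈ Ioo 0 a) => tendsto_capLaw_Iic hF hg ha hq hν hx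
  have hprobH : ∀ α, 1 < α → IsProbabilityMeasure (highestLaw 2 (ν α)) := fun α hα => by
    have := hprob α hα
    exact isProbabilityMeasure_highestLaw (ν α) (by omega)
  have hmemH : ∀ α, 1 < α → ∀ᵐ x ∂(highestLaw 2 (ν α)), x ∈ Icc 0 (q α) := fun α hα => by
    have := hprob α hα
    exact ae_highestLaw_mem (by omega) (hmem α hα)
  have hS : Tendsto (fun α => ∫ x, truncatedSurplus F g x ∂(highestLaw 2 (ν α))) atTop
      (𝓝 (truncatedSurplus F g a)) := by
    refine tendsto_integral_of_concentrates ha hqa hprobH hq0 hmemH (fun x hx => ?_)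
      (hg.truncatedSurplus_monotoneOn hF) (hg.truncatedSurplus_continuousOn hF)
      fun x hx => hg.truncatedSurplus_nonneg hF hx
    have h1 : Tendsto (fun α => (ν α).real (Iic x) ^ 2) atTop (𝓝 (0 ^ 2)) := (hG x hx).pow 2
    rw [zero_pow two_ne_zero] at h1
    refine h1.congr' ((eventually_gt_atTop 1).mono fun α hα => ?_)
    have := hprob α hα
    exact (highestLaw_real_Iic (ν α) (by omega) x).symm
  have hD : Tendsto (fun α => ∫ x, floorGain F g x ∂(secondLaw 2 (ν α))) atTop
      (𝓝 (floorGain F g a)) := by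
    refine tendsto_integral_of_concentrates ha hqa (fun α hα => ?_) hq0 (fun α hα => ?_)
      (fun x hx => ?_) (hg.floorGain_monotoneOn hF) (hg.floorGain_continuousOn hF)
      fun x hx => hg.floorGain_nonneg hF hx
    · have := hprob α hα
      exact isProbabilityMeasure_secondLaw (ν α) le_rfl
    · have := hprob α hα
      exact ae_secondLaw_mem le_rfl (hmem α hα)
    · have h1 : Tendsto (fun α => 2 * (ν α).real (Iic x) - (ν α).real (Iic x) ^ 2) atTop
          (𝓝 (2 * 0 - 0 ^ 2)) := ((hG x hx).const_mul 2).sub ((hG x hx).pow 2)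
      rw [show (2 * 0 - 0 ^ 2 : ℝ) = 0 by norm_num] at h1
      refine h1.congr' ((eventually_gt_atTop 1).mono fun α hα => ?_)
      have := hprob α hα
      beta_reduce
      rw [secondLaw_real_Iic (ν α) le_rfl x]
      norm_num
  have hcost : ∀ μ : ℝ → Measure ℝ, (∀ α, 1 < α → IsProbabilityMeasure (μ α)) →
      (∀ α, 1 < α → ∀ᵐ x ∂(μ α), x ∈ Icc 0 (q α)) →
      Tendsto (fun α => ∫ x, powerCost a α x ∂(μ α)) atTop (𝓝 0) := by
    intro μ hμ hμm
    refine squeeze_zero' ?_ ?_ (tendsto_cost_monopolyCap hF hg ha hq)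
    · filter_upwards [eventually_gt_atTop 1] with α hα
      exact integral_nonneg_of_ae ((hμm α hα).mono fun x hx => powerCost_nonneg ha hx.1)
    · filter_upwards [eventually_gt_atTop 1] with α hα
      have := hμ α hα
      have hm := powerCost_monotoneOn ha hα
      have := integral_mono_ae (integrable_of_monotoneOn_Icc (hq0 α hα) (hμm α hα)
        (hm.mono Icc_subset_Ici_self)) (integrable_const (powerCost a α (q α)))
        ((hμm α hα).mono fun x hx => hm hx.1 (hq0 α hα) hx.2)
      simpa using this
  constructor
  · have h1 := (hS.sub (hcost _ hprobH hmemH)).add hD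
    rw [sub_zero] at h1
    refine h1.congr' ((eventually_gt_atTop 1).mono fun α hα => ?_)
    have := hprob α hα
    have := hprobH α hα
    have hm := powerCost_monotoneOn ha hα
    beta_reduce
    rw [hg.expectedWelfare_eq hF hm le_rfl (hq0 α hα) (hmem α hα), integral_sub
      (integrable_of_monotoneOn_Icc (hq0 α hα) (hmemH α hα)
        ((hg.truncatedSurplus_monotoneOn hF).mono Icc_subset_Ici_self))
      (integrable_of_monotoneOn_Icc (hq0 α hα) (hmemH α hα) (hm.mono Icc_subset_Ici_self))]
  · have h1 := (hS.add hD).sub ((hcost ν hprob hmem).const_mul 2)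
    rw [mul_zero, sub_zero] at h1
    refine h1.congr' ((eventually_gt_atTop 1).mono fun α hα => ?_)
    have := hprob α hα
    beta_reduce
    rw [hg.expectedNetSurplus_eq hF (powerCost_monotoneOn ha hα) le_rfl (hq0 α hα) (hmem α hα)]
    norm_num

end Limit

/-! ### Uniform types: positivity and value of the limiting gain -/

section Uniform
variable {g : ℝ → ℝ} {a : ℝ}

theorem density_uniformTypes {θ : ℝ} (hθ : θ ∈ Θ) : density uniformTypes θ = 1 :=
  derivWithin_id θ Θ (uniqueDiffOn_Icc zero_lt_one θ hθ)

theorem virtualValue_uniformTypes {θ : ℝ} (hθ : θ ∈ Θ) :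
    virtualValue uniformTypes θ = 2 * θ - 1 := by
  rw [virtualValue, density_uniformTypes hθ, uniformTypes]
  ring

theorem regularTypes_uniform : RegularTypes uniformTypes where
  map_zero := rfl
  map_one := rfl
  differentiable := differentiableOn_id
  density_differentiable :=
    (differentiableOn_const 1).congr fun _ hθ => density_uniformTypes hθ
  density_pos θ hθ := by
    rw [density_uniformTypes (Ico_subset_Icc_self hθ)]
    exact one_pos
  virtualValue_strictMono := fun x hx y hy hxy => by
    rw [virtualValue_uniformTypes hx, virtualValue_uniformTypes hy]
    linarith

theorem ConcaveUtility.floorGain_pos (hg : ConcaveUtility g) (ha : 0 < a)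
    (h : virtualMaximizer uniformTypes g 0 < ENNReal.ofReal a) :
    0 < floorGain uniformTypes g a := by
  have hF := regularTypes_uniform
  have h0 : virtualValue uniformTypes 0 < 0 := by
    rw [virtualValue_uniformTypes zero_mem_types]
    norm_num
  obtain ⟨b, hb, hmax⟩ := hg.exists_maximizer _ h0
  rw [virtualMaximizer_of_neg h0 hb hmax] at h
  have hba : b < a := (ENNReal.ofReal_lt_ofReal_iff ha).1 h
  have hlt := hmax a ha.le hba.ne'
  rw [virtualValue_uniformTypes zero_mem_types] at hlt
  -- Type 0 has measure zero and puts no weight on quality beyond g, so the strict preference for b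
  -- over a is carried by continuity to a type δ > 0. All types in (0, δ) then choose less than a
  -- and gain strictly from the floor.
  obtain ⟨δ, hδlt, hδ⟩ : ∃ δ, (g a + (2 * δ - 1) * a < g b + (2 * δ - 1) * b) ∧
      δ ∈ Ioo (0 : ℝ) 1 := by
    have hc : Continuous fun δ : ℝ => (g b + (2 * δ - 1) * b) - (g a + (2 * δ - 1) * a) := by
      fun_prop
    have h1 : ∀ᶠ δ in 𝓝[>] (0 : ℝ),
        0 < (g b + (2 * δ - 1) * b) - (g a + (2 * δ - 1) * a) :=
      (hc.continuousAt.mono_left nhdsWithin_le_nhds).eventually (lt_mem_nhds (sub_pos.2 hlt))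
    obtain ⟨δ, hδ, hδ'⟩ := (h1.and (Ioo_mem_nhdsGT (one_pos (α := ℝ)))).exists
    exact ⟨δ, sub_pos.1 hδ, hδ'⟩
  have hδΘ : δ ∈ Θ := Ioo_subset_Icc_self hδ
  have hBδ : truncatedMaximizer uniformTypes g a δ < a := by
    refine lt_of_le_of_ne (truncatedMaximizer_le ha.le) fun heq => ?_
    have := hg.virtualSurplus_le (F := uniformTypes) (θ := δ) hb hba.le
    rw [heq, virtualSurplus, virtualSurplus, virtualValue_uniformTypes hδΘ] at this
    linarith
  refine lt_of_le_of_ne (hg.floorGain_nonneg hF ha.le) fun hzero => ?_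
  have hnn : 0 ≤ᵐ[typeLaw uniformTypes] fun θ =>
      utility g a θ - utility g (truncatedMaximizer uniformTypes g a θ) θ :=
    (ae_typeLaw_mem _).mono fun θ hθ => sub_nonneg.2
      (utility_mono hg hθ (truncatedMaximizer_nonneg _ _ _ _) (truncatedMaximizer_le ha.le))
  have hae := hF.absolutelyContinuous_typeLaw.ae_le
    ((integral_eq_zero_iff_of_nonneg_ae hnn (hg.integrable_floorGain hF ha.le)).1 hzero.symm)
  obtain ⟨θ, hθ, heq⟩ := exists_mem_Ioo_of_ae
    ((ae_restrict_iff' measurableSet_types).1 hae) hδ.1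
  have hθΘ : θ ∈ Θ := ⟨hθ.1.le, hθ.2.le.trans hδ.2.le⟩
  have h1 := heq hθΘ
  have h2 := (hg.truncatedMaximizer_monotoneOn hF ha.le hθΘ hδΘ hθ.2.le).trans_lt hBδ
  have h3 := hg.monotoneOn (truncatedMaximizer_nonneg uniformTypes g a θ) ha.le h2.le
  have h4 := mul_lt_mul_of_pos_left h2 hθ.1
  simp only [utility, Pi.zero_apply] at h1
  linarith

theorem linearUtility_maximizer {p : ℝ} (hp : p < 0) (q : ℝ) (hq : 0 ≤ q) (hne : q ≠ 0) :
    linearUtility q + p * q < linearUtility 0 + p * 0 := by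
  have := mul_neg_of_neg_of_pos hp (lt_of_le_of_ne hq hne.symm)
  simpa [linearUtility] using this

/-- Types below 1/2 have φ < 0 and are excluded by the monopolist; the floor gives each of them θ a.
All other types already receive a. -/
theorem floorGain_uniform_linear (ha : 0 < a) :
    floorGain uniformTypes linearUtility a = a / 8 := by
  rw [floorGain, regularTypes_uniform.integral_typeLaw]
  have e : ∫ θ in (0 : ℝ)..1, density uniformTypes θ * (utility linearUtility a θ -
      utility linearUtility (truncatedMaximizer uniformTypes linearUtility a θ) θ) =
      ∫ θ in (0 : ℝ)..1, (Iio (1 / 2)).indicator (fun θ => θ * a) θ := by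
    refine intervalIntegral.integral_congr fun θ hθ => ?_
    rw [uIcc_of_le zero_le_one] at hθ
    simp only [density_uniformTypes hθ, utility, linearUtility]
    by_cases h : θ < 1 / 2
    · have hneg : virtualValue uniformTypes θ < 0 := by
        rw [virtualValue_uniformTypes hθ]
        linarith
      rw [truncatedMaximizer_of_neg hneg le_rfl (linearUtility_maximizer hneg) ha.le,
        indicator_of_mem (mem_Iio.2 h), min_eq_left ha.le]
      ring
    · have hpos : 0 ≤ virtualValue uniformTypes θ := by
        rw [virtualValue_uniformTypes hθ]
        linarith
      rw [truncatedMaximizer_of_nonneg hpos ha.le, indicator_of_notMem (by simpa using h)]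
      ring
  have hset : Ioc (0 : ℝ) 1 ∩ Iio (1 / 2) = Ioo 0 (1 / 2) := by
    ext θ
    simp only [mem_inter_iff, mem_Ioc, mem_Iio, mem_Ioo]
    constructor
    · rintro ⟨⟨h1, -⟩, h2⟩
      exact ⟨h1, h2⟩
    · rintro ⟨h1, h2⟩
      exact ⟨⟨h1, by linarith⟩, h2⟩
  rw [e, intervalIntegral.integral_of_le zero_le_one, setIntegral_indicator measurableSet_Iio, hset,
    ← integral_Ioc_eq_integral_Ioo, ← intervalIntegral.integral_of_le (by norm_num),
    intervalIntegral.integral_mul_const, integral_id]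
  ring

end Uniform

end DigitalMonopoly

/-! ### The main theorem -/

theorem mainTheorem10 :
    -- Expected welfare is nonincreasing in the number of active firms, and full bunching makes
    -- monopoly welfare exceed duopoly welfare.
    (∀ F g c : ℝ → ℝ, RegularTypes F → RegularUtility g → RegularCost c →
      (∀ n : ℕ, 2 ≤ n → ∀ ν ν' : Measure ℝ, IsCapLaw F g c n ν → IsCapLaw F g c (n + 1) ν' →
        expectedWelfare F g c (n + 1) ν' ≤ expectedWelfare F g c n ν ∧
        expectedNetSurplus F g c (n + 1) ν' ≤ expectedNetSurplus F g c n ν) ∧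
      (∀ (qM : ℝ) (A : ℝ → ℝ) (ν : Measure ℝ), IsMonopolyCap F g c qM →
        IsMonopolist F g c A → IsCapLaw F g c 2 ν →
        ENNReal.ofReal qM ≤ virtualMaximizer F g 0 →
        expectedWelfare F g c 2 ν < welfare F g c A ∧
        expectedNetSurplus F g c 2 ν < welfare F g c A)) ∧
    -- Uniform types, costs close to fixed, no full bunching: duopoly dominates in the limit.
    (∀ (g : ℝ → ℝ) (a : ℝ), RegularUtility g ∨ g = linearUtility →
      virtualMaximizer uniformTypes g 0 < ENNReal.ofReal a →
      ∀ (A : ℝ → ℝ → ℝ) (ν : ℝ → Measure ℝ),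
        (∀ α, 1 < α → IsMonopolist uniformTypes g (powerCost a α) (A α)) →
        (∀ α, 1 < α → IsCapLaw uniformTypes g (powerCost a α) 2 (ν α)) →
        ∃ wM wD : ℝ, wM < wD ∧
          Tendsto (fun α => welfare uniformTypes g (powerCost a α) (A α)) atTop (𝓝 wM) ∧
          Tendsto (fun α => expectedWelfare uniformTypes g (powerCost a α) 2 (ν α))
            atTop (𝓝 wD) ∧
          Tendsto (fun α => expectedNetSurplus uniformTypes g (powerCost a α) 2 (ν α))
            atTop (𝓝 wD)) ∧
    -- With linear utility the gain from duopoly converges to `a / 8`.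
    (∀ a : ℝ, 0 < a →
      ∀ (A : ℝ → ℝ → ℝ) (ν : ℝ → Measure ℝ),
        (∀ α, 1 < α → IsMonopolist uniformTypes linearUtility (powerCost a α) (A α)) →
        (∀ α, 1 < α → IsCapLaw uniformTypes linearUtility (powerCost a α) 2 (ν α)) →
        Tendsto (fun α => expectedWelfare uniformTypes linearUtility (powerCost a α) 2 (ν α) -
          welfare uniformTypes linearUtility (powerCost a α) (A α)) atTop (𝓝 (a / 8)) ∧
        Tendsto (fun α => expectedNetSurplus uniformTypes linearUtility (powerCost a α) 2 (ν α) -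
          welfare uniformTypes linearUtility (powerCost a α) (A α)) atTop (𝓝 (a / 8))) := by
  refine ⟨fun F g c hF hg' hc => ⟨fun n hn ν ν' h h' => ?_, fun qM A ν hq hA h hb => ?_⟩, ?_, ?_⟩
  · have hg := hg'.concaveUtility
    obtain ⟨qM, hq, -⟩ := h.2
    exact ⟨h.expectedWelfare_succ_le hF hg hc.strictConvex hc.strictMono.monotoneOn hn hq h',
      h.expectedNetSurplus_succ_le hF hg hc hn hq h'⟩
  · have hg := hg'.concaveUtility
    have := h.1
    have hlt := expectedWelfare_lt_of_bunching hF hg hc hq hA h hb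
    exact ⟨hlt, (hg.expectedNetSurplus_le hF hc.strictMono.monotoneOn hc.nonneg le_rfl hq.1
      (h.ae_mem hF hg hc.strictConvex hq)).trans_lt hlt⟩
  · intro g a hg' hb A ν hA hν
    have hg : ConcaveUtility g := hg'.elim (fun h => h.concaveUtility)
      fun h => h ▸ concaveUtility_linear
    have ha : 0 < a := ENNReal.ofReal_pos.1 (hb.trans_le' zero_le)
    exact ⟨_, _, lt_add_of_pos_right _ (hg.floorGain_pos ha hb),
      tendsto_monopolyWelfare regularTypes_uniform hg ha hA hν,
      tendsto_duopolyWelfare regularTypes_uniform hg ha hν⟩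
  · intro a ha A ν hA hν
    have hM := tendsto_monopolyWelfare regularTypes_uniform concaveUtility_linear ha hA hν
    have hD := tendsto_duopolyWelfare regularTypes_uniform concaveUtility_linear ha hν
    have h1 := hD.1.sub hM
    have h2 := hD.2.sub hM
    rw [add_sub_cancel_left, floorGain_uniform_linear ha] at h1 h2
    exact ⟨h1, h2⟩
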